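/- Let $k$ be an algebraically closed field of characteristic $0$, let $\gamma\ge 2$, and let $f\in k[x]$ be separable of degree $2\gamma+1$ with $f(0)\neq 0$. Let $B$ be the hyperelliptic curve $y^2=f(x)$ of genus $\gamma$, with point at infinity $q$; let $p=(0,\sqrt{f(0)})$ for a fixed square root of $f(0)$, and let $\sum_{i\ge 0}a_ix^i\in k[[x]]$ be the square root of $f$ with $a_0=\sqrt{f(0)}$. For $d\ge 0$ let $\Theta_d\subset \mathrm{Jac}(B)$ be the set of classes $[p_1+\dots+p_d-dq]$ with $p_1,\dots,p_d\in B$, and let $\Theta^0_d=\Theta_d\setminus\Theta_{d-1}$ (with $\Theta_{-1}=\emptyset$). The multiplication profile of $x\in \mathrm{Jac}(B)$ is the sequence $m(x)=(m_j)_{j\ge 1}$ of non-negative integers with $jx\in\Theta^0_{m_j}$ for all $j\ge 1$. For $n\ge\gamma+1$ let $D_n$ be the determinant of the Hankel matrix $(a_{\gamma+2+i+j})_{0\le i,j<(n-\gamma-1)/2}$ if $n+\gamma$ is odd, and of $(a_{\gamma+1+i+j})_{0\le i,j<(n-\gamma)/2}$ if $n+\gamma$ is even (so $D_{\gamma+1}=1$,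 an empty determinant). Suppose that $[p-q]$ has order precisely $N$, where $1\le N<\infty$. Let $(\epsilon_j)_{j\ge 1}$ be a sequence of non-negative integers satisfying the following necessary conditions for all $i,j\ge 1$: - $\epsilon_1=1$, $\epsilon_j\le\gamma$, $\epsilon_{j+N}=\epsilon_j$, and $\epsilon_{N-j}=\epsilon_j$ if $j<N$; - $\epsilon_j=0$ if and only if $N\mid j$; - $\epsilon_{\gamma+2}\in\{\gamma-1,\gamma\}$; - $\epsilon_i+\epsilon_j\ge\epsilon_{i+j}$; - $(\epsilon_j,\epsilon_{j+1},\epsilon_{j+2})\neq(a,a+1,a)$ for every $a$; - $(\epsilon_j,\epsilon_{j+1})\ne(a,a)$ for every $a<\gamma$. Then $m([p-q])=(\epsilon_j)$ if and only if, for every $j$ with $\gamma+1\le j\le\lfloor N/2\rfloor$, one has $D_j=0$ exactly when $\epsilon_j<\gamma$. In particular, the profile is determined by its entries in that range: $m([p-q])=(\epsilon_j)$ if and only if $j[p-q]\in\Theta^0_{\epsilon_j}$ for all $\gamma+1\le j\le \lfloor N/2\rfloor$; and if $f'$, $p'$ is another pair as above (same $k$ and $\gamma$), with point at infinity $q'$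 and $[p'-q']$ of the same order $N$, and $m([p-q])$ and $m([p'-q'])$ agree in all entries with $\gamma+1\le j\le\lfloor N/2\rfloor$, then they are equal. -/

import Mathlib

open Polynomial

namespace OddHyperelliptic

/-- The affine coordinate ring `k[x,y]/(y² - f(x))` of the curve `y² = f(x)`
(`x` is the inner variable, `y` the outer one). -/
abbrev CoordRing {k : Type*} [Field k] (f : k[X]) : Type _ :=
  AdjoinRoot ((X : k[X][X]) ^ 2 - C f)

/-- The (closed) points of the smooth projective model `B` of `y² = f(x)`, where `f` is separable
of odd degree over an algebraically closed field: the affine points `(a, b)` with `b² = f(a)`,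
and the unique point `q` at infinity, a Weierstrass point. -/
inductive Point {k : Type*} [Field k] (f : k[X]) : Type _
  | infinity : Point f
  | affine (a b : k) (h : b ^ 2 = f.eval a) : Point f

/-- Evaluation of a regular function on the affine curve at the point `(a, b)`. -/
noncomputable def evalAt {k : Type*} [Field k] (f : k[X]) (a b : k) (h : b ^ 2 = f.eval a) :
    CoordRing f →+* k :=
  AdjoinRoot.lift (evalRingHom a) b (by simp [h])

/-- The maximal ideal of the affine point `(a, b)`. -/
noncomputable def maxIdeal {k : Type*} [Field k] (f : k[X]) (a b : k) (h : b ^ 2 = f.eval a) :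
    Ideal (CoordRing f) :=
  RingHom.ker (evalAt f a b h)

/-- The `i`-th coefficient (`i = 0, 1`) of a regular function `g = u(x) + v(x) y` on the
affine curve: `coord f g 0 = u` and `coord f g 1 = v`. -/
noncomputable def coord {k : Type*} [Field k] (f : k[X]) (g : CoordRing f) (i : ℕ) : k[X] :=
  (AdjoinRoot.modByMonicHom (monic_X_pow_sub_C f two_ne_zero) g).coeff i

/-- The order of pole at infinity of a nonzero `g = u(x) + v(x) y`, which is the maximum of
`2 deg u` and `deg f + 2 deg v` (over the nonzero ones among `u` and `v`): the functions `x` and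
`y` have poles of order `2` and `deg f` there, and no cancellation occurs as `deg f` is odd. -/
noncomputable def poleOrder {k : Type*} [Field k] (f : k[X]) (g : CoordRing f) : ℕ :=
  open Classical in
  max (2 * (coord f g 0).natDegree)
    (if coord f g 1 = 0 then 0 else f.natDegree + 2 * (coord f g 1).natDegree)

/-- The order at a point of `B` of a nonzero regular function `g` on the affine curve.
At an affine point with maximal ideal `m` it is the largest `n` with `g ∈ m ^ n`. -/
noncomputable def ordAt {k : Type*} [Field k] (f : k[X]) (g : CoordRing f) : Point f → ℤ
  | Point.infinity => -(poleOrder f g : ℤ)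
  | Point.affine a b h => ((sSup {n : ℕ | g ∈ maxIdeal f a b h ^ n} : ℕ) : ℤ)

/-- Divisors on `B`. -/
abbrev Divisor {k : Type*} [Field k] (f : k[X]) : Type _ := Point f →₀ ℤ

/-- The subgroup of principal divisors. Every nonzero rational function on `B` is a quotient of
nonzero regular functions on the affine curve, so it is generated by the divisors of the latter. -/
noncomputable def principal {k : Type*} [Field k] (f : k[X]) : AddSubgroup (Divisor f) :=
  AddSubgroup.closure {D | ∃ g : CoordRing f, g ≠ 0 ∧ ∀ P, D P = ordAt f g P}

/-- The subgroup of divisors of degree zero. -/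
noncomputable def degZero {k : Type*} [Field k] (f : k[X]) : AddSubgroup (Divisor f) :=
  (Finsupp.liftAddHom (fun _ : Point f => AddMonoidHom.id ℤ)).ker

/-- The group of points of the Jacobian of `B`: divisors of degree zero modulo principal
divisors. -/
abbrev Jac {k : Type*} [Field k] (f : k[X]) : Type _ :=
  degZero f ⧸ (principal f).addSubgroupOf (degZero f)

/-- The class `[P - q]`, where `q` is the point at infinity. -/
noncomputable def pointClass {k : Type*} [Field k] {f : k[X]} (P : Point f) : Jac f :=
  QuotientAddGroup.mk
    (⟨Finsupp.single P 1 - Finsupp.single Point.infinity 1,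
      by
        rw [degZero, AddMonoidHom.mem_ker, map_sub]; simp⟩ : degZero f)

/-- `Θ_d`, the image of the `d`-th Abel–Jacobi map
`(P₁, …, P_d) ↦ [P₁ + ⋯ + P_d - d q]`. -/
def Theta {k : Type*} [Field k] (f : k[X]) (d : ℕ) : Set (Jac f) :=
  Set.range fun P : Fin d → Point f => ∑ i, pointClass (P i)

/-- `Θ⁰_d = Θ_d ∖ Θ_{d-1}`, with `Θ_{-1} = ∅`. -/
def ThetaZero {k : Type*} [Field k] (f : k[X]) : ℕ → Set (Jac f)
  | 0 => Theta f 0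
  | d + 1 => Theta f (d + 1) \ Theta f d

/-- `(e 1, e 2, …)` is the multiplication profile of `x`, that is `j x ∈ Θ⁰_{e j}` for all
`j ≥ 1`. The value `e 0` plays no role. -/
def IsMultProfile {k : Type*} [Field k] {f : k[X]} (x : Jac f) (e : ℕ → ℕ) : Prop :=
  ∀ j, 1 ≤ j → j • x ∈ ThetaZero f (e j)

/-- The necessary conditions on a sequence `(e 1, e 2, …)` to be the multiplication profile of
a class `[p - q]` of order `N` on a curve of genus `γ`. -/
structure NecessaryConditions (γ N : ℕ) (e : ℕ → ℕ) : Prop where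
  one : e 1 = 1
  le_genus : ∀ j, 1 ≤ j → e j ≤ γ
  periodic : ∀ j, 1 ≤ j → e (j + N) = e j
  symmetric : ∀ j, 1 ≤ j → j < N → e (N - j) = e j
  eq_zero_iff : ∀ j, 1 ≤ j → (e j = 0 ↔ N ∣ j)
  genus_add_two : e (γ + 2) = γ - 1 ∨ e (γ + 2) = γ
  subadditive : ∀ i j, 1 ≤ i → 1 ≤ j → e (i + j) ≤ e i + e j
  no_peak : ∀ j a, 1 ≤ j → ¬(e j = a ∧ e (j + 1) = a + 1 ∧ e (j + 2) = a)
  no_plateau : ∀ j a, 1 ≤ j → a < γ → ¬(e j = a ∧ e (j + 1) = a)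

/-- The Hankel determinant `D_n` (for `n ≥ γ + 1`) of a sequence `a`, with top left entry
`a (γ + 2)` if `n + γ` is odd and `a (γ + 1)` if `n + γ` is even, and with bottom right entry
`a (n - 1)`. For `n = γ + 1` the matrix is empty and `D_n = 1`. -/
def hankelDet {k : Type*} [Field k] (γ : ℕ) (a : ℕ → k) (n : ℕ) : k :=
  if Odd (n + γ) then
    (Matrix.of fun i j : Fin ((n - γ - 1) / 2) => a (γ + 2 + (i : ℕ) + (j : ℕ))).det
  else
    (Matrix.of fun i j : Fin ((n - γ) / 2) => a (γ + 1 + (i : ℕ) + (j : ℕ))).det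

end OddHyperelliptic

/-! Write p̄ = (0, -b) for the hyperelliptic conjugate of p. Since p + p̄ ∼ 2q, the class j[p - q]
lies in Θ_m exactly when j p̄ + E ∼ (j + deg E) q for some effective affine E of degree at most m.
That means: some nonzero regular function u(x) + v(x) y has a pole of order at most j + m at q and
vanishes to order at least j at p̄ (`nsmul_pointClass_mem_Theta_iff`). Near p̄ the function y is
minus the chosen square root of f, so this is a Padé problem: with t a square root of f modulo x^j,
find u, v of bounded degree with x^j ∣ u - v t (`hasFunction_iff`).

For m = γ there are more unknown coefficients than equations, so every entry of the profile is at
most γ. For m = γ - 1 and j ≥ γ + 1 the system is square; eliminating u leaves a Hankel system for v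
with determinant D_j. Hence D_j = 0 exactly when the j-th entry is below γ
(`hasFunction_iff_hankelDet`).

The rest is combinatorial. The profile and any admissible sequence change by at most 1 at each step,
have no plateau below γ and no isolated peak (`ProfileLike`). For 1 ≤ a < γ an entry is then at most
a - 1 iff it and its two neighbours are at most a (`le_pred_iff`), so the set of indices with entry
below γ determines all lower levels. Periodicity and symmetry reduce to 1 ≤ j ≤ N/2, and for j ≤ γ
the entry must be j, so only γ + 1 ≤ j ≤ N/2 matters. Of characteristic 0 only 2 ≠ 0 is used. -/

namespace OddHyperelliptic

/-! ### The affine coordinate ring: norm, pole order, Dedekind property -/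

section Ring

variable {k : Type*} [Field k] {f : k[X]}

/-- The regular function `u(x) + v(x) y`. -/
noncomputable def elt (f u v : k[X]) : CoordRing f :=
  AdjoinRoot.of _ u + AdjoinRoot.of _ v * AdjoinRoot.root _

lemma root_sq : (AdjoinRoot.root ((X : k[X][X]) ^ 2 - C f)) ^ 2 = AdjoinRoot.of _ f := by
  have h := AdjoinRoot.eval₂_root ((X : k[X][X]) ^ 2 - C f)
  simpa [sub_eq_zero] using h

lemma coord_mk (p : k[X][X]) (hp : p.natDegree < 2) (i : ℕ) :
    coord f (AdjoinRoot.mk _ p) i = p.coeff i := by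
  rw [coord, AdjoinRoot.modByMonicHom_mk, (modByMonic_eq_self_iff _).2]
  · rw [degree_X_pow_sub_C two_pos]
    exact lt_of_le_of_lt degree_le_natDegree (by exact_mod_cast hp)
  · exact monic_X_pow_sub_C f two_ne_zero

lemma elt_eq_mk (u v : k[X]) :
    elt f u v = AdjoinRoot.mk ((X : k[X][X]) ^ 2 - C f) (C u + C v * X) := by
  simp [elt]

lemma natDegree_lin_lt (u v : k[X]) : (C u + C v * X : k[X][X]).natDegree < 2 := by
  rw [add_comm]
  exact lt_of_le_of_lt natDegree_linear_le (by norm_num)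

@[simp] lemma coord_elt_zero (u v : k[X]) : coord f (elt f u v) 0 = u := by
  rw [elt_eq_mk, coord_mk _ (natDegree_lin_lt u v)]; simp

@[simp] lemma coord_elt_one (u v : k[X]) : coord f (elt f u v) 1 = v := by
  rw [elt_eq_mk, coord_mk _ (natDegree_lin_lt u v)]; simp

lemma elt_coord (g : CoordRing f) : elt f (coord f g 0) (coord f g 1) = g := by
  have hm := monic_X_pow_sub_C f two_ne_zero
  conv_rhs => rw [← AdjoinRoot.mk_leftInverse hm g]
  have hd : (AdjoinRoot.modByMonicHom hm g).natDegree ≤ 1 := by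
    obtain ⟨p, rfl⟩ := AdjoinRoot.mk_surjective g
    rw [AdjoinRoot.modByMonicHom_mk]
    have := natDegree_modByMonic_lt p hm (by
      intro h
      have := congrArg natDegree h
      rw [natDegree_X_pow_sub_C] at this
      simp at this)
    rw [natDegree_X_pow_sub_C] at this
    omega
  rw [elt_eq_mk, add_comm]
  conv_rhs => rw [Polynomial.eq_X_add_C_of_natDegree_le_one hd]
  rfl

lemma exists_elt (g : CoordRing f) : ∃ u v, g = elt f u v := ⟨_, _, (elt_coord g).symm⟩

lemma elt_inj {u v u' v' : k[X]} : elt f u v = elt f u' v' ↔ u = u' ∧ v = v' := by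
  refine ⟨fun h ↦ ⟨?_, ?_⟩, fun h ↦ by rw [h.1, h.2]⟩
  · simpa using congrArg (fun g ↦ coord f g 0) h
  · simpa using congrArg (fun g ↦ coord f g 1) h

lemma of_eq_elt (u : k[X]) : AdjoinRoot.of ((X : k[X][X]) ^ 2 - C f) u = elt f u 0 := by
  simp [elt]

lemma zero_eq_elt : (0 : CoordRing f) = elt f 0 0 := by simp [elt]

lemma elt_ne_zero {u v : k[X]} : elt f u v ≠ 0 ↔ u ≠ 0 ∨ v ≠ 0 := by
  rw [zero_eq_elt, Ne, elt_inj]; tauto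

lemma elt_mul (u v u' v' : k[X]) :
    elt f u v * elt f u' v' = elt f (u * u' + v * v' * f) (u * v' + v * u') := by
  simp only [elt, map_add, map_mul]
  linear_combination (AdjoinRoot.of _ v * AdjoinRoot.of _ v') * root_sq (f := f)

lemma elt_add (u v u' v' : k[X]) : elt f u v + elt f u' v' = elt f (u + u') (v + v') := by
  simp only [elt, map_add]; ring

lemma elt_sub (u v u' v' : k[X]) : elt f u v - elt f u' v' = elt f (u - u') (v - v') := by
  simp only [elt, map_sub]; ring

lemma of_injective : Function.Injective (AdjoinRoot.of ((X : k[X][X]) ^ 2 - C f)) := by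
  intro u v h
  rw [of_eq_elt, of_eq_elt, elt_inj] at h
  exact h.1

/-- The hyperelliptic involution on regular functions, `y ↦ -y`. -/
noncomputable def conj (f : k[X]) : CoordRing f →+* CoordRing f :=
  AdjoinRoot.lift (AdjoinRoot.of _) (-AdjoinRoot.root _) (by simp [root_sq])

lemma conj_elt (u v : k[X]) : conj f (elt f u v) = elt f u (-v) := by
  simp [conj, elt]

lemma conj_conj (g : CoordRing f) : conj f (conj f g) = g := by
  obtain ⟨u, v, rfl⟩ := exists_elt g
  simp [conj_elt]

/-- The norm to `k[x]` of a regular function. -/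
noncomputable def normPoly (f : k[X]) (g : CoordRing f) : k[X] :=
  coord f g 0 ^ 2 - coord f g 1 ^ 2 * f

lemma normPoly_elt (u v : k[X]) : normPoly f (elt f u v) = u ^ 2 - v ^ 2 * f := by
  simp [normPoly]

lemma mul_conj (g : CoordRing f) : g * conj f g = AdjoinRoot.of _ (normPoly f g) := by
  obtain ⟨u, v, rfl⟩ := exists_elt g
  rw [conj_elt, elt_mul, normPoly_elt, of_eq_elt, elt_inj]
  constructor <;> ring

lemma normPoly_mul (g h : CoordRing f) : normPoly f (g * h) = normPoly f g * normPoly f h := by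
  apply of_injective (f := f)
  rw [map_mul, ← mul_conj, ← mul_conj, ← mul_conj, map_mul]
  ring

/-- The degrees of u² and v² f have opposite parity, so their leading terms cannot cancel. This
makes the norm nonzero with degree equal to the pole order, which yields both the domain property
and additivity of pole orders. -/
lemma natDegree_normPoly_elt (hf : Odd f.natDegree) {u v : k[X]} (h : u ≠ 0 ∨ v ≠ 0) :
    u ^ 2 - v ^ 2 * f ≠ 0 ∧ (u ^ 2 - v ^ 2 * f).natDegree = max (2 * u.natDegree)
      (open Classical in if v = 0 then 0 else f.natDegree + 2 * v.natDegree) := by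
  have hf0 : f ≠ 0 := by rintro rfl; simp at hf
  by_cases hv : v = 0
  · have hu : u ≠ 0 := by tauto
    simp [hv, hu, natDegree_pow]
  have hd : (v ^ 2 * f).natDegree = f.natDegree + 2 * v.natDegree := by
    rw [natDegree_mul (pow_ne_zero _ hv) hf0, natDegree_pow, add_comm]
  rw [if_neg hv]
  by_cases hu : u = 0
  · subst hu
    simp only [ne_eq, OfNat.ofNat_ne_zero, not_false_eq_true, zero_pow, zero_sub, neg_eq_zero,
      natDegree_neg, hd, natDegree_zero, mul_zero, zero_le, sup_of_le_right, and_true]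
    exact mul_ne_zero (pow_ne_zero _ hv) hf0
  have hu2 : (u ^ 2).natDegree = 2 * u.natDegree := natDegree_pow _ _
  have hne : (u ^ 2).natDegree ≠ (v ^ 2 * f).natDegree := by
    rw [hu2, hd]
    rintro h
    obtain ⟨c, hc⟩ := hf
    omega
  constructor
  · intro h0
    exact hne (congrArg natDegree (sub_eq_zero.1 h0))
  · rcases lt_or_gt_of_ne hne with h1 | h1
    · rw [natDegree_sub_eq_right_of_natDegree_lt h1, ← hu2, ← hd, max_eq_right h1.le]
    · rw [natDegree_sub_eq_left_of_natDegree_lt h1, ← hu2, ← hd, max_eq_left h1.le]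

lemma normPoly_ne_zero (hf : Odd f.natDegree) {g : CoordRing f} (hg : g ≠ 0) :
    normPoly f g ≠ 0 := by
  obtain ⟨u, v, rfl⟩ := exists_elt g
  rw [normPoly_elt]
  exact (natDegree_normPoly_elt hf (elt_ne_zero.1 hg)).1

lemma natDegree_normPoly (hf : Odd f.natDegree) {g : CoordRing f} (hg : g ≠ 0) :
    (normPoly f g).natDegree = poleOrder f g := by
  obtain ⟨u, v, rfl⟩ := exists_elt g
  rw [normPoly_elt, (natDegree_normPoly_elt hf (elt_ne_zero.1 hg)).2, poleOrder,
    coord_elt_zero, coord_elt_one]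

lemma nontrivial_coordRing : Nontrivial (CoordRing f) :=
  ⟨elt f 1 0, 0, elt_ne_zero.2 (Or.inl one_ne_zero)⟩

lemma isDomain_coordRing (hf : Odd f.natDegree) : IsDomain (CoordRing f) := by
  have := nontrivial_coordRing (f := f)
  have : NoZeroDivisors (CoordRing f) := ⟨fun {a b} hab ↦ by
    by_contra! h
    have := mul_ne_zero (normPoly_ne_zero hf h.1) (normPoly_ne_zero hf h.2)
    rw [← normPoly_mul, hab, normPoly] at this
    rw [zero_eq_elt] at this
    simp at this⟩
  exact NoZeroDivisors.to_isDomain _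

lemma poleOrder_mul (hf : Odd f.natDegree) {g h : CoordRing f} (hg : g ≠ 0) (hh : h ≠ 0) :
    poleOrder f (g * h) = poleOrder f g + poleOrder f h := by
  have := isDomain_coordRing hf
  rw [← natDegree_normPoly hf hg, ← natDegree_normPoly hf hh,
    ← natDegree_normPoly hf (mul_ne_zero hg hh), normPoly_mul,
    natDegree_mul (normPoly_ne_zero hf hg) (normPoly_ne_zero hf hh)]

lemma evalAt_elt {a b : k} (h : b ^ 2 = f.eval a) (u v : k[X]) :
    evalAt f a b h (elt f u v) = u.eval a + v.eval a * b := by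
  simp [evalAt, elt]

lemma mem_maxIdeal {a b : k} (h : b ^ 2 = f.eval a) (u v : k[X]) :
    elt f u v ∈ maxIdeal f a b h ↔ u.eval a + v.eval a * b = 0 := by
  rw [maxIdeal, RingHom.mem_ker, evalAt_elt]

lemma evalAt_surjective {a b : k} (h : b ^ 2 = f.eval a) :
    Function.Surjective (evalAt f a b h) := fun c ↦
  ⟨elt f (C c) 0, by simp [evalAt_elt]⟩

lemma maxIdeal_isMaximal {a b : k} (h : b ^ 2 = f.eval a) : (maxIdeal f a b h).IsMaximal :=
  RingHom.ker_isMaximal_of_surjective _ (evalAt_surjective h)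

lemma maxIdeal_ne_bot {a b : k} (h : b ^ 2 = f.eval a) : maxIdeal f a b h ≠ ⊥ := by
  intro h0
  have : elt f (X - C a) 0 ∈ maxIdeal f a b h := by simp [mem_maxIdeal]
  rw [h0, Ideal.mem_bot] at this
  exact elt_ne_zero.2 (Or.inl (X_sub_C_ne_zero a)) this

/-- The maximal ideal of `(a, b)` is generated by `x - a` and `y - b`. -/
lemma exists_of_mem_maxIdeal {a b : k} (h : b ^ 2 = f.eval a) {g : CoordRing f}
    (hg : g ∈ maxIdeal f a b h) :
    ∃ r s, g = elt f (X - C a) 0 * r + elt f (-C b) 1 * s := by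
  obtain ⟨u, v, rfl⟩ := exists_elt g
  rw [mem_maxIdeal] at hg
  obtain ⟨u', hu⟩ := X_sub_C_dvd_sub_C_eval (p := u) (a := a)
  obtain ⟨v', hv⟩ := X_sub_C_dvd_sub_C_eval (p := v) (a := a)
  refine ⟨elt f u' v', elt f (C (v.eval a)) 0, ?_⟩
  rw [elt_mul, elt_mul, elt_add, elt_inj]
  have hC : C (u.eval a) + C (v.eval a) * C b = 0 := by
    rw [← C_mul, ← C_add, hg, C_0]
  constructor
  · linear_combination hu + hC
  · linear_combination hv

/-- A local uniformizer at `(a, b)`. -/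
lemma exists_uniformizer [NeZero (2 : k)] (hsep : f.Separable) {a b : k}
    (h : b ^ 2 = f.eval a) :
    ∃ π ∈ maxIdeal f a b h, ∃ w ∉ maxIdeal f a b h, ∀ g ∈ maxIdeal f a b h, π ∣ w * g := by
  by_cases hb : b = 0
  · subst hb
    have hroot : f.eval a = 0 := by simpa using h.symm
    obtain ⟨f₁, hf₁⟩ := dvd_iff_isRoot.2 hroot
    -- At a Weierstrass point y is the uniformizer: y² = (x - a) f₁, and separability makes f₁ a
    -- unit there.
    refine ⟨elt f 0 1, by simp [mem_maxIdeal], elt f f₁ 0, ?_, fun g hg ↦ ?_⟩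
    · rw [mem_maxIdeal]
      intro h0
      have h2 : f₁.eval a = 0 := by simpa using h0
      have h3 := hsep.eval₂_derivative_ne_zero (RingHom.id k) (x := a) (by simpa using hroot)
      rw [hf₁] at h3
      simp [h2] at h3
    · obtain ⟨r, s, rfl⟩ := exists_of_mem_maxIdeal h hg
      refine ⟨elt f 0 1 * r + elt f f₁ 0 * s, ?_⟩
      have e1 : elt f f₁ 0 * elt f (X - C a) 0 = elt f 0 1 * elt f 0 1 := by
        rw [elt_mul, elt_mul, elt_inj]
        constructor
        · linear_combination -hf₁
        · ring
      have e2 : elt f (-C 0) 1 = elt f 0 1 := by simp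
      rw [e2]
      linear_combination r * e1
  -- Elsewhere x - a is the uniformizer: (y + b)(y - b) = (x - a) f₁, and y + b takes the value 2b ≠
  -- 0.
  · refine ⟨elt f (X - C a) 0, by simp [mem_maxIdeal], elt f (C b) 1, ?_, fun g hg ↦ ?_⟩
    · rw [mem_maxIdeal]
      have : (2 : k) * b ≠ 0 := mul_ne_zero two_ne_zero hb
      simpa [two_mul] using this
    · obtain ⟨r, s, rfl⟩ := exists_of_mem_maxIdeal h hg
      obtain ⟨f₁, hf₁⟩ := X_sub_C_dvd_sub_C_eval (p := f) (a := a)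
      refine ⟨elt f (C b) 1 * r + elt f f₁ 0 * s, ?_⟩
      have e1 : elt f (C b) 1 * elt f (-C b) 1 = elt f (X - C a) 0 * elt f f₁ 0 := by
        rw [elt_mul, elt_mul, elt_inj]
        constructor
        · have : C b ^ 2 = C (f.eval a) := by rw [← C_pow, h]
          linear_combination hf₁ - this
        · ring
      linear_combination s * e1

/-- A nonzero prime contains the norm of a nonzero element, hence a linear factor x - a of it, hence
one of y ± b with b² = f(a). -/
lemma exists_eq_maxIdeal [IsAlgClosed k] (hf : Odd f.natDegree) {I : Ideal (CoordRing f)}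
    (hI : I ≠ ⊥) [hp : I.IsPrime] : ∃ a b h, I = maxIdeal f a b h := by
  obtain ⟨g, hg, hg0⟩ := Submodule.exists_mem_ne_zero_of_ne_bot hI
  have hN : AdjoinRoot.of _ (normPoly f g) ∈ I := by
    rw [← mul_conj]; exact I.mul_mem_right _ hg
  have hP : (I.comap (AdjoinRoot.of ((X : k[X][X]) ^ 2 - C f))).IsPrime := inferInstance
  have hspl := IsAlgClosed.splits (normPoly f g)
  have hx : ∃ a, AdjoinRoot.of ((X : k[X][X]) ^ 2 - C f) (X - C a) ∈ I := by
    rw [hspl.eq_prod_roots] at hN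
    have hN' : C (normPoly f g).leadingCoeff *
      ((normPoly f g).roots.map fun a ↦ X - C a).prod ∈
        I.comap (AdjoinRoot.of ((X : k[X][X]) ^ 2 - C f)) := hN
    rcases hP.mem_or_mem hN' with h1 | h1
    · exact absurd (Ideal.eq_top_of_isUnit_mem _ h1 (isUnit_C.2 (IsUnit.mk0 _
        (leadingCoeff_ne_zero.2 (normPoly_ne_zero hf hg0))))) hP.ne_top
    · obtain ⟨p, hp1, hp2⟩ := (Ideal.IsPrime.multiset_prod_mem_iff_exists_mem hP _).1 h1
      obtain ⟨a, -, rfl⟩ := Multiset.mem_map.1 hp1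
      exact ⟨a, hp2⟩
  obtain ⟨a, ha⟩ := hx
  obtain ⟨b, hb⟩ := IsAlgClosed.exists_pow_nat_eq (f.eval a) two_pos
  obtain ⟨f₁, hf₁⟩ := X_sub_C_dvd_sub_C_eval (p := f) (a := a)
  have hmul : elt f (C b) 1 * elt f (-C b) 1 ∈ I := by
    have : elt f (C b) 1 * elt f (-C b) 1 = elt f (X - C a) 0 * elt f f₁ 0 := by
      rw [elt_mul, elt_mul, elt_inj]
      constructor
      · have : C b ^ 2 = C (f.eval a) := by rw [← C_pow, hb]
        linear_combination hf₁ - this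
      · ring
    rw [this, ← of_eq_elt]
    exact I.mul_mem_right _ ha
  have key : ∀ c, c ^ 2 = f.eval a → elt f (-C c) 1 ∈ I → ∃ a b h, I = maxIdeal f a b h := by
    intro c hc hcI
    refine ⟨a, c, hc, ((maxIdeal_isMaximal hc).eq_of_le hp.ne_top fun z hz ↦ ?_).symm⟩
    obtain ⟨r, s, rfl⟩ := exists_of_mem_maxIdeal hc hz
    rw [of_eq_elt] at ha
    exact I.add_mem (I.mul_mem_right _ ha) (I.mul_mem_right _ hcI)
  rcases hp.mem_or_mem hmul with h1 | h1
  · exact key (-b) (by rw [neg_sq, hb]) (by simpa using h1)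
  · exact key b hb h1

open IsLocalRing in
lemma isDedekindDomain_coordRing [IsAlgClosed k] [NeZero (2 : k)] (hf : Odd f.natDegree)
    (hsep : f.Separable) : IsDedekindDomain (CoordRing f) := by
  have := isDomain_coordRing hf
  have : IsDedekindDomainDvr (CoordRing f) := by
    refine { toIsNoetherian := inferInstanceAs (IsNoetherianRing (CoordRing f))
             is_dvr_at_nonzero_prime := ?_ }
    intro P hP hPp
    obtain ⟨a, b, h, rfl⟩ := exists_eq_maxIdeal hf hP
    set m := maxIdeal f a b h with hm
    have hnf : ¬ IsField (Localization.AtPrime m) :=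
      IsLocalization.AtPrime.not_isField _ hP _
    refine ((IsDiscreteValuationRing.TFAE (Localization.AtPrime m) hnf).out 0 4).2 ?_
    obtain ⟨π, hπ, w, hw, hdiv⟩ := exists_uniformizer hsep h
    refine ⟨algebraMap _ _ π, le_antisymm ?_ ?_⟩
    · rw [← Localization.AtPrime.map_eq_maximalIdeal, Ideal.map_le_iff_le_comap]
      intro g hg
      obtain ⟨r, hr⟩ := hdiv g hg
      have hwu : IsUnit (algebraMap (CoordRing f) (Localization.AtPrime m) w) :=
        IsLocalization.map_units (M := m.primeCompl) _ ⟨w, hw⟩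
      rw [Ideal.mem_comap, Ideal.submodule_span_eq, Ideal.mem_span_singleton,
        ← hwu.dvd_mul_left, ← map_mul, hr, map_mul]
      exact dvd_mul_right _ _
    · rw [← Localization.AtPrime.map_eq_maximalIdeal]
      rw [Ideal.submodule_span_eq, Ideal.span_singleton_le_iff_mem]
      exact Ideal.mem_map_of_mem _ hπ
  infer_instance

end Ring
-- Divisors of zeros of regular functions
section Zeros

variable {k : Type*} [Field k] {f : k[X]}

/-- The ideal of a point; the unit ideal for the point at infinity. -/
noncomputable def idealOf : Point f → Ideal (CoordRing f)
  | Point.infinity => ⊤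
  | Point.affine a b h => maxIdeal f a b h

/-- The hyperelliptic involution. -/
def Point.conj : Point f → Point f
  | Point.infinity => Point.infinity
  | Point.affine a b h => Point.affine a (-b) (by rw [neg_sq, h])

lemma idealOf_injective : Function.Injective (idealOf (f := f)) := by
  have hX : ∀ a b (h : b ^ 2 = f.eval a), elt f (X - C a) 0 ∈ maxIdeal f a b h := by
    simp [mem_maxIdeal]
  have hY : ∀ a b (h : b ^ 2 = f.eval a), elt f (-C b) 1 ∈ maxIdeal f a b h := by
    simp [mem_maxIdeal]
  rintro (_ | ⟨a, b, h⟩) (_ | ⟨a', b', h'⟩) he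
  · rfl
  · exact absurd he.symm (maxIdeal_isMaximal h').ne_top
  · exact absurd he (maxIdeal_isMaximal h).ne_top
  · change maxIdeal f a b h = maxIdeal f a' b' h' at he
    have h1 := hX a b h
    have h2 := hY a b h
    rw [he, mem_maxIdeal] at h1 h2
    obtain rfl : a = a' := by
      have : a' - a = 0 := by simpa using h1
      exact (sub_eq_zero.1 this).symm
    obtain rfl : b = b' := by
      have : -b + b' = 0 := by simpa using h2
      linear_combination -this
    rfl

lemma idealOf_ne_bot (P : Point f) : idealOf P ≠ ⊥ := by
  have := nontrivial_coordRing (f := f)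
  rcases P with _ | ⟨a, b, h⟩
  · exact top_ne_bot
  · exact maxIdeal_ne_bot h

/-- `Z` is the multiset of zeros of the regular function `g` on the affine curve. -/
def IsZeros (g : CoordRing f) (Z : Multiset (Point f)) : Prop :=
  Point.infinity ∉ Z ∧ Ideal.span {g} = (Z.map idealOf).prod

lemma IsZeros.mul {g h : CoordRing f} {Z W : Multiset (Point f)} (hg : IsZeros g Z)
    (hh : IsZeros h W) : IsZeros (g * h) (Z + W) := by
  refine ⟨by simp [hg.1, hh.1], ?_⟩
  rw [← Ideal.span_singleton_mul_span_singleton, hg.2, hh.2, Multiset.map_add, Multiset.prod_add]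

lemma map_conj_maxIdeal {a b : k} (h : b ^ 2 = f.eval a) (h' : (-b) ^ 2 = f.eval a) :
    (maxIdeal f a b h).map (conj f) = maxIdeal f a (-b) h' := by
  have key : ∀ b (h : b ^ 2 = f.eval a) (h' : (-b) ^ 2 = f.eval a) g, g ∈ maxIdeal f a b h →
      conj f g ∈ maxIdeal f a (-b) h' := by
    intro b h h' g hg
    obtain ⟨u, v, rfl⟩ := exists_elt g
    rw [conj_elt, mem_maxIdeal] at *
    simpa using hg
  apply le_antisymm
  · rw [Ideal.map_le_iff_le_comap]
    exact fun g hg ↦ key b h h' g hg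
  · intro g hg
    rw [← conj_conj g]
    apply Ideal.mem_map_of_mem
    have := key (-b) h' (by rw [neg_neg, h]) g hg
    simpa using this

lemma map_conj_idealOf (P : Point f) : (idealOf P).map (conj f) = idealOf P.conj := by
  rcases P with _ | ⟨a, b, h⟩
  · exact Ideal.map_top _
  · exact map_conj_maxIdeal h _

lemma IsZeros.conj {g : CoordRing f} {Z : Multiset (Point f)} (hg : IsZeros g Z) :
    IsZeros (OddHyperelliptic.conj f g) (Z.map Point.conj) := by
  refine ⟨?_, ?_⟩
  · rw [Multiset.mem_map]
    rintro ⟨_ | ⟨a, b, h⟩, hP, h'⟩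
    · exact hg.1 hP
    · cases h'
  · have := congrArg (Ideal.mapHom (OddHyperelliptic.conj f)) hg.2
    rw [map_multiset_prod, Multiset.map_map] at this
    rw [Multiset.map_map]
    change Ideal.map _ _ = _ at this
    rw [Ideal.map_span, Set.image_singleton] at this
    rw [this]
    congr 1
    exact Multiset.map_congr rfl fun P _ ↦ map_conj_idealOf P

lemma isZeros_X_sub_C [NeZero (2 : k)] (hsep : f.Separable) {a b : k} (h : b ^ 2 = f.eval a) :
    IsZeros (elt f (X - C a) 0) {Point.affine a b h, (Point.affine a b h).conj} := by
  refine ⟨by simp [Point.conj], ?_⟩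
  have h' : (-b) ^ 2 = f.eval a := by rw [neg_sq, h]
  change _ = (Multiset.map idealOf (Point.affine a b h ::ₘ {Point.affine a (-b) h'})).prod
  simp only [Multiset.map_cons, Multiset.map_singleton, Multiset.prod_cons,
    Multiset.prod_singleton, idealOf]
  obtain ⟨f₁, hf₁⟩ := X_sub_C_dvd_sub_C_eval (p := f) (a := a)
  have e1 : elt f (-C b) 1 * elt f (-C (-b)) 1 = elt f (X - C a) 0 * elt f f₁ 0 := by
    rw [elt_mul, elt_mul, elt_inj]
    constructor
    · have : C b ^ 2 = C (f.eval a) := by rw [← C_pow, h]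
      rw [C_neg]
      linear_combination hf₁ - this
    · rw [C_neg]; ring
  apply le_antisymm
  · rw [Ideal.span_singleton_le_iff_mem]
    by_cases hb : b = 0
    · subst hb
      have hroot : f.eval a = 0 := by simpa using h.symm
      have h2 : f₁.eval a ≠ 0 := by
        intro h2
        have h3 := hsep.eval₂_derivative_ne_zero (RingHom.id k) (x := a) (by simpa using hroot)
        rw [sub_eq_iff_eq_add.1 hf₁] at h3
        simp [h2] at h3
      have hc : IsCoprime (X - C a) f₁ :=
        ((prime_X_sub_C a).coprime_iff_not_dvd).2 fun hd ↦ h2 (dvd_iff_isRoot.1 hd)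
      obtain ⟨A, B, hAB⟩ := hc
      -- The Bézout relation A (x - a) + B f₁ = 1 multiplied by x - a, with (x - a) f₁ = y².
      have e2 : elt f (X - C a) 0 = elt f A 0 * (elt f (X - C a) 0 * elt f (X - C a) 0) +
          elt f B 0 * (elt f 0 1 * elt f 0 1) := by
        simp only [elt_mul, elt_add]
        rw [elt_inj]
        rw [hroot] at hf₁
        simp only [C_0] at hf₁
        constructor
        · linear_combination -(X - C a) * hAB - B * hf₁
        · ring
      rw [e2]
      refine Ideal.add_mem _ (Ideal.mul_mem_left _ _ (Ideal.mul_mem_mul ?_ ?_))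
        (Ideal.mul_mem_left _ _ (Ideal.mul_mem_mul ?_ ?_)) <;> simp [mem_maxIdeal]
    · have h2 : (2 : k) * b ≠ 0 := mul_ne_zero two_ne_zero hb
      have e2 : elt f (X - C a) 0 = elt f (C (2 * b)⁻¹) 0 *
          (elt f (X - C a) 0 * elt f (-C (-b)) 1 - elt f (-C b) 1 * elt f (X - C a) 0) := by
        simp only [elt_mul, elt_sub]
        rw [elt_inj]
        have : C (2 * b)⁻¹ * C (2 * b) = 1 := by
          rw [← C_mul, inv_mul_cancel₀ h2, C_1]
        rw [C_mul, C_ofNat] at this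
        constructor
        · rw [C_neg]; linear_combination -(X - C a) * this
        · ring
      rw [e2]
      refine Ideal.mul_mem_left _ _ (Ideal.sub_mem _ (Ideal.mul_mem_mul ?_ ?_)
        (Ideal.mul_mem_mul ?_ ?_)) <;> simp [mem_maxIdeal]
  · rw [Ideal.mul_le]
    intro r hr s hs
    obtain ⟨r₁, r₂, rfl⟩ := exists_of_mem_maxIdeal h hr
    obtain ⟨s₁, s₂, rfl⟩ := exists_of_mem_maxIdeal h' hs
    rw [Ideal.mem_span_singleton]
    refine ⟨r₁ * (elt f (X - C a) 0 * s₁ + elt f (-C (-b)) 1 * s₂) +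
      elt f (-C b) 1 * r₂ * s₁ + elt f f₁ 0 * r₂ * s₂, ?_⟩
    linear_combination r₂ * s₂ * e1

lemma prod_idealOf_ne_bot (hf : Odd f.natDegree) (Z : Multiset (Point f)) :
    (Z.map idealOf).prod ≠ ⊥ := by
  have := isDomain_coordRing hf
  refine Multiset.prod_ne_zero fun h ↦ ?_
  obtain ⟨P, -, hP⟩ := Multiset.mem_map.1 h
  exact idealOf_ne_bot P hP

lemma isZeros_C {c : k} (hc : c ≠ 0) : IsZeros (elt f (C c) 0) 0 := by
  refine ⟨by simp, ?_⟩
  rw [Multiset.map_zero, Multiset.prod_zero, Ideal.one_eq_top, Ideal.span_singleton_eq_top,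
    ← of_eq_elt]
  exact (isUnit_C.2 (IsUnit.mk0 _ hc)).map _

section Dedekind

variable [IsAlgClosed k] [NeZero (2 : k)]

lemma idealOf_prime (hf : Odd f.natDegree) (hsep : f.Separable) {P : Point f}
    (hP : P ≠ Point.infinity) : Prime (idealOf P) := by
  have := isDedekindDomain_coordRing hf hsep
  rcases P with _ | ⟨a, b, h⟩
  · exact absurd rfl hP
  · exact Ideal.prime_of_isPrime (maxIdeal_ne_bot h) (maxIdeal_isMaximal h).isPrime

/-- Unique factorization of ideals. Infinity is excluded because its ideal is the unit ideal and
would be invisible in the product. -/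
lemma prod_dvd_prod_iff (hf : Odd f.natDegree) (hsep : f.Separable) {Z W : Multiset (Point f)}
    (hZ : Point.infinity ∉ Z) (hW : Point.infinity ∉ W) :
    (Z.map idealOf).prod ∣ (W.map idealOf).prod ↔ Z ≤ W := by
  classical
  have := isDedekindDomain_coordRing hf hsep
  have key : ∀ Z : Multiset (Point f), Point.infinity ∉ Z →
      UniqueFactorizationMonoid.normalizedFactors (Z.map idealOf).prod = Z.map idealOf := by
    intro Z hZ
    apply UniqueFactorizationMonoid.normalizedFactors_prod_of_prime
    intro I hI
    obtain ⟨P, hP, rfl⟩ := Multiset.mem_map.1 hI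
    exact idealOf_prime hf hsep fun h ↦ hZ (h ▸ hP)
  rw [UniqueFactorizationMonoid.dvd_iff_normalizedFactors_le_normalizedFactors
    (prod_idealOf_ne_bot hf Z) (prod_idealOf_ne_bot hf W), key Z hZ, key W hW,
    Multiset.map_le_map_iff idealOf_injective]

lemma IsZeros.unique (hf : Odd f.natDegree) (hsep : f.Separable) {g : CoordRing f}
    {Z W : Multiset (Point f)} (hZ : IsZeros g Z) (hW : IsZeros g W) : Z = W := by
  have h := hZ.2.symm.trans hW.2
  exact le_antisymm ((prod_dvd_prod_iff hf hsep hZ.1 hW.1).1 h.dvd)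
    ((prod_dvd_prod_iff hf hsep hW.1 hZ.1).1 h.symm.dvd)

lemma exists_isZeros (hf : Odd f.natDegree) (hsep : f.Separable) {g : CoordRing f}
    (hg : g ≠ 0) : ∃ Z, IsZeros g Z := by
  classical
  have := isDedekindDomain_coordRing hf hsep
  have hg' : Ideal.span {g} ≠ ⊥ := by simpa using hg
  have key : ∀ M : Multiset (Ideal (CoordRing f)), (∀ I ∈ M, Prime I) →
      ∃ Z : Multiset (Point f), Point.infinity ∉ Z ∧ Z.map idealOf = M := by
    intro M
    induction M using Multiset.induction with
    | empty => exact fun _ ↦ ⟨0, by simp, by simp⟩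
    | cons I M ih =>
      intro hM
      obtain ⟨Z, hZ, rfl⟩ := ih fun J hJ ↦ hM J (Multiset.mem_cons_of_mem hJ)
      have hI := hM I (Multiset.mem_cons_self _ _)
      have := Ideal.isPrime_of_prime hI
      obtain ⟨a, b, h, rfl⟩ := exists_eq_maxIdeal hf hI.ne_zero
      exact ⟨Point.affine a b h ::ₘ Z, by simp [hZ], by simp [idealOf]⟩
  obtain ⟨Z, hZ, hZ'⟩ := key (UniqueFactorizationMonoid.normalizedFactors (Ideal.span {g}))
    fun I hI ↦ UniqueFactorizationMonoid.prime_of_normalized_factor I hI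
  exact ⟨Z, hZ, by rw [hZ', Ideal.prod_normalizedFactors_eq_self hg']⟩

open Classical in
lemma IsZeros.mem_pow_iff (hf : Odd f.natDegree) (hsep : f.Separable) {g : CoordRing f}
    {Z : Multiset (Point f)} (hZ : IsZeros g Z) {a b : k} (h : b ^ 2 = f.eval a) (n : ℕ) :
    g ∈ maxIdeal f a b h ^ n ↔ n ≤ Z.count (Point.affine a b h) := by
  have := isDedekindDomain_coordRing hf hsep
  have e : maxIdeal f a b h ^ n =
      ((Multiset.replicate n (Point.affine a b h)).map idealOf).prod := by simp [idealOf]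
  rw [← Ideal.dvd_span_singleton, hZ.2, e, prod_dvd_prod_iff hf hsep _ hZ.1,
    Multiset.le_count_iff_replicate_le]
  intro h0
  cases Multiset.eq_of_mem_replicate h0

open Classical in
lemma IsZeros.ordAt_affine (hf : Odd f.natDegree) (hsep : f.Separable) {g : CoordRing f}
    {Z : Multiset (Point f)} (hZ : IsZeros g Z) {a b : k} (h : b ^ 2 = f.eval a) :
    ordAt f g (Point.affine a b h) = Z.count (Point.affine a b h) := by
  have : {n : ℕ | g ∈ maxIdeal f a b h ^ n} = Set.Iic (Z.count (Point.affine a b h)) := by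
    ext n
    exact hZ.mem_pow_iff hf hsep h n
  rw [ordAt, this, csSup_Iic]

lemma exists_isZeros_of (hsep : f.Separable) {p : k[X]} (hp : p ≠ 0) :
    ∃ Z, IsZeros (AdjoinRoot.of ((X : k[X][X]) ^ 2 - C f) p) Z ∧
      Multiset.card Z = 2 * p.natDegree := by
  have key : ∀ s : Multiset k, ∃ Z, IsZeros (AdjoinRoot.of ((X : k[X][X]) ^ 2 - C f)
      (s.map fun a ↦ X - C a).prod) Z ∧ Multiset.card Z = 2 * Multiset.card s := by
    intro s
    induction s using Multiset.induction with
    | empty => exact ⟨0, by simpa [of_eq_elt] using isZeros_C (f := f) one_ne_zero, by simp⟩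
    | cons a s ih =>
      obtain ⟨Z, hZ, hc⟩ := ih
      obtain ⟨b, hb⟩ := IsAlgClosed.exists_pow_nat_eq (f.eval a) two_pos
      have := (isZeros_X_sub_C hsep hb).mul hZ
      rw [← of_eq_elt, ← map_mul] at this
      refine ⟨_, by simpa using this, ?_⟩
      simp [hc]; ring
  have hs := IsAlgClosed.splits p
  obtain ⟨Z, hZ, hc⟩ := key p.roots
  refine ⟨Z, ?_, by rw [hc, hs.natDegree_eq_card_roots]⟩
  have := (isZeros_C (f := f) (leadingCoeff_ne_zero.2 hp)).mul hZ
  rw [← of_eq_elt, ← map_mul, ← hs.eq_prod_roots, zero_add] at this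
  exact this

/-- The zeros of g together with their conjugates are the zeros of the norm, a polynomial in x whose
degree is the pole order and each of whose roots carries two points. -/
lemma IsZeros.card_eq (hf : Odd f.natDegree) (hsep : f.Separable) {g : CoordRing f}
    (hg : g ≠ 0) {Z : Multiset (Point f)} (hZ : IsZeros g Z) :
    Multiset.card Z = poleOrder f g := by
  obtain ⟨W, hW, hc⟩ := exists_isZeros_of (f := f) hsep (normPoly_ne_zero hf hg)
  have h := hZ.mul hZ.conj
  rw [mul_conj] at h
  have h2 := congrArg Multiset.card (h.unique hf hsep hW)
  rw [hc, Multiset.card_add, Multiset.card_map] at h2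
  rw [← natDegree_normPoly hf hg]
  omega

end Dedekind

end Zeros

/-! ### From multiples of the class to functions with prescribed zeros and poles -/

section Jacobian

variable {k : Type*} [Field k] {f : k[X]}

lemma zero_mem_Theta : (0 : Jac f) ∈ Theta f 0 := ⟨Fin.elim0, by simp⟩

lemma add_mem_Theta {a b : ℕ} {z w : Jac f} (hz : z ∈ Theta f a) (hw : w ∈ Theta f b) :
    z + w ∈ Theta f (a + b) := by
  obtain ⟨P, rfl⟩ := hz
  obtain ⟨Q, rfl⟩ := hw
  exact ⟨Fin.append P Q, by simp [Fin.sum_univ_add]⟩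

lemma pointClass_mem_Theta (P : Point f) : pointClass P ∈ Theta f 1 := ⟨fun _ ↦ P, by simp⟩

lemma pointClass_infinity : pointClass (Point.infinity : Point f) = 0 := by
  rw [pointClass]
  simp only [sub_self]
  rfl

lemma Theta_succ_subset (d : ℕ) : Theta f d ⊆ Theta f (d + 1) := fun z hz ↦ by
  have := add_mem_Theta hz (pointClass_mem_Theta (Point.infinity : Point f))
  rwa [pointClass_infinity, add_zero] at this

lemma Theta_mono : Monotone (Theta f) := monotone_nat_of_le_succ Theta_succ_subset

open Classical in
lemma sum_pointClass_filter (Z : Multiset (Point f)) :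
    ((Z.filter (· ≠ Point.infinity)).map pointClass).sum = (Z.map pointClass).sum := by
  induction Z using Multiset.induction with
  | empty => simp
  | cons P Z ih =>
    by_cases h : P = Point.infinity
    · rw [Multiset.filter_cons_of_neg _ (by simpa using h), ih, Multiset.map_cons,
        Multiset.sum_cons, h, pointClass_infinity, zero_add]
    · rw [Multiset.filter_cons_of_pos (p := (· ≠ Point.infinity)) _ h, Multiset.map_cons, Multiset.sum_cons, ih,
        Multiset.map_cons, Multiset.sum_cons]

/-- Copies of q have class zero, so they can be dropped or used as padding. -/
lemma mem_Theta_iff {m : ℕ} {z : Jac f} : z ∈ Theta f m ↔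
    ∃ Z : Multiset (Point f), Point.infinity ∉ Z ∧ Multiset.card Z ≤ m ∧
      (Z.map pointClass).sum = z := by
  classical
  constructor
  · rintro ⟨P, rfl⟩
    refine ⟨(Finset.univ.val.map P).filter (· ≠ Point.infinity), by simp, ?_, ?_⟩
    · exact (Multiset.card_le_card (Multiset.filter_le _ _)).trans (by simp)
    · rw [sum_pointClass_filter, Multiset.map_map]
      rfl
  · rintro ⟨Z, -, hc, rfl⟩
    refine Theta_mono hc ?_
    clear hc
    induction Z using Multiset.induction with
    | empty => simpa using zero_mem_Theta
    | cons P Z ih =>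
      rw [Multiset.map_cons, Multiset.sum_cons, Multiset.card_cons, add_comm (pointClass P)]
      exact add_mem_Theta ih (pointClass_mem_Theta P)

lemma sum_pointClass_eq_zero_iff (Z : Multiset (Point f)) :
    (Z.map pointClass).sum = 0 ↔
      (Z.map fun P ↦ (Finsupp.single P 1 - Finsupp.single Point.infinity 1 : Divisor f)).sum ∈
        principal f := by
  have key : ∃ D : degZero f, (Z.map pointClass).sum = QuotientAddGroup.mk D ∧ (D : Divisor f) =
      (Z.map fun P ↦ (Finsupp.single P 1 - Finsupp.single Point.infinity 1 : Divisor f)).sum := by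
    induction Z using Multiset.induction with
    | empty => exact ⟨0, by simp, by simp⟩
    | cons P Z ih =>
      obtain ⟨D, h1, h2⟩ := ih
      refine ⟨⟨Finsupp.single P 1 - Finsupp.single Point.infinity 1, by
        rw [degZero, AddMonoidHom.mem_ker, map_sub]; simp⟩ + D, ?_, ?_⟩
      · rw [Multiset.map_cons, Multiset.sum_cons, h1]; rfl
      · rw [Multiset.map_cons, Multiset.sum_cons, ← h2]; rfl
  obtain ⟨D, h1, h2⟩ := key
  rw [h1, ← h2, QuotientAddGroup.eq_zero_iff, AddSubgroup.mem_addSubgroupOf]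

open Classical in
lemma sum_single_apply (Z : Multiset (Point f)) (P : Point f) :
    (Z.map fun P ↦ (Finsupp.single P 1 - Finsupp.single Point.infinity 1 : Divisor f)).sum P =
      Z.count P - if P = Point.infinity then (Multiset.card Z : ℤ) else 0 := by
  induction Z using Multiset.induction with
  | empty => simp
  | cons Q Z ih =>
    rw [Multiset.map_cons, Multiset.sum_cons, Finsupp.add_apply, ih, Multiset.count_cons,
      Multiset.card_cons, Finsupp.sub_apply, Finsupp.single_apply, Finsupp.single_apply]
    simp only [eq_comm (a := P)]
    split_ifs <;> push_cast <;> ring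

variable [IsAlgClosed k] [NeZero (2 : k)]

lemma IsZeros.sum_pointClass (hf : Odd f.natDegree) (hsep : f.Separable) {g : CoordRing f}
    (hg : g ≠ 0) {Z : Multiset (Point f)} (hZ : IsZeros g Z) : (Z.map pointClass).sum = 0 := by
  classical
  rw [sum_pointClass_eq_zero_iff]
  refine AddSubgroup.subset_closure ⟨g, hg, fun P ↦ ?_⟩
  rw [sum_single_apply]
  rcases P with _ | ⟨a, b, h⟩
  · rw [Multiset.count_eq_zero.2 hZ.1, ordAt, ← hZ.card_eq hf hsep hg]
    simp
  · rw [hZ.ordAt_affine hf hsep h]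
    simp

lemma pointClass_conj (hf : Odd f.natDegree) (hsep : f.Separable) (P : Point f) :
    pointClass P.conj = -pointClass P := by
  rcases P with _ | ⟨a, b, h⟩
  · rw [Point.conj, pointClass_infinity, neg_zero]
  · have := (isZeros_X_sub_C hsep h).sum_pointClass hf hsep
      (elt_ne_zero.2 (Or.inl (X_sub_C_ne_zero a)))
    rw [eq_neg_iff_add_eq_zero, add_comm]
    simpa using this

lemma neg_mem_Theta (hf : Odd f.natDegree) (hsep : f.Separable) {d : ℕ} {z : Jac f}
    (hz : z ∈ Theta f d) : -z ∈ Theta f d := by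
  obtain ⟨P, rfl⟩ := hz
  exact ⟨fun i ↦ (P i).conj, by simp [pointClass_conj hf hsep]⟩

lemma ordAt_mul (hf : Odd f.natDegree) (hsep : f.Separable) {g h : CoordRing f} (hg : g ≠ 0)
    (hh : h ≠ 0) (P : Point f) : ordAt f (g * h) P = ordAt f g P + ordAt f h P := by
  classical
  obtain ⟨Z, hZ⟩ := exists_isZeros hf hsep hg
  obtain ⟨W, hW⟩ := exists_isZeros hf hsep hh
  rcases P with _ | ⟨a, b, h⟩
  · simp only [ordAt, poleOrder_mul hf hg hh]; push_cast; ring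
  · rw [(hZ.mul hW).ordAt_affine hf hsep, hZ.ordAt_affine hf hsep, hW.ordAt_affine hf hsep,
      Multiset.count_add]
    push_cast; rfl

lemma exists_ordAt_of_mem_principal (hf : Odd f.natDegree) (hsep : f.Separable)
    {D : Divisor f} (hD : D ∈ principal f) :
    ∃ g h : CoordRing f, g ≠ 0 ∧ h ≠ 0 ∧ ∀ P, D P + ordAt f h P = ordAt f g P := by
  have := isDomain_coordRing hf
  induction hD using AddSubgroup.closure_induction with
  | mem D h =>
    obtain ⟨g, hg, hD⟩ := h
    refine ⟨g, 1, hg, one_ne_zero, fun P ↦ ?_⟩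
    have := ordAt_mul hf hsep (f := f) one_ne_zero one_ne_zero P
    rw [mul_one] at this
    rw [hD]
    omega
  | zero => exact ⟨1, 1, one_ne_zero, one_ne_zero, by simp⟩
  | add D E _ _ h1 h2 =>
    obtain ⟨g, h, hg, hh, e⟩ := h1
    obtain ⟨g', h', hg', hh', e'⟩ := h2
    refine ⟨g * g', h * h', mul_ne_zero hg hg', mul_ne_zero hh hh', fun P ↦ ?_⟩
    rw [ordAt_mul hf hsep hg hg', ordAt_mul hf hsep hh hh', ← e, ← e', Finsupp.add_apply]
    ring
  | neg D _ h1 =>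
    obtain ⟨g, h, hg, hh, e⟩ := h1
    refine ⟨h, g, hh, hg, fun P ↦ ?_⟩
    rw [← e, Finsupp.neg_apply]
    ring

/-- An effective affine divisor `Z` with `Z ∼ (card Z) q` is the divisor of zeros of a regular
function. -/
lemma exists_isZeros_of_sum_eq_zero (hf : Odd f.natDegree) (hsep : f.Separable)
    {Z : Multiset (Point f)} (hZ : Point.infinity ∉ Z) (hsum : (Z.map pointClass).sum = 0) :
    ∃ g : CoordRing f, g ≠ 0 ∧ IsZeros g Z := by
  classical
  have := isDedekindDomain_coordRing hf hsep
  obtain ⟨g, h, hg, hh, e⟩ := exists_ordAt_of_mem_principal hf hsep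
    ((sum_pointClass_eq_zero_iff Z).1 hsum)
  obtain ⟨G, hG⟩ := exists_isZeros hf hsep hg
  obtain ⟨H, hH⟩ := exists_isZeros hf hsep hh
  have hGH : G = H + Z := by
    ext P
    rcases P with _ | ⟨a, b, h⟩
    · rw [Multiset.count_add, Multiset.count_eq_zero.2 hG.1, Multiset.count_eq_zero.2 hH.1,
        Multiset.count_eq_zero.2 hZ]
    · have := e (Point.affine a b h)
      rw [hG.ordAt_affine hf hsep, hH.ordAt_affine hf hsep, sum_single_apply] at this
      simp only [reduceCtorEq, if_false, sub_zero] at this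
      rw [Multiset.count_add]
      omega
  have hspan : Ideal.span {g} = Ideal.span {h} * (Z.map idealOf).prod := by
    rw [hG.2, hH.2, hGH, Multiset.map_add, Multiset.prod_add]
  -- The divisor is that of g / h; being effective on the affine part, it forces g / h to be regular
  -- there, since (g) is a multiple of (h).
  have hdvd : h ∣ g := by
    rw [← Ideal.mem_span_singleton, ← Ideal.dvd_span_singleton]
    exact ⟨_, hspan⟩
  obtain ⟨r, rfl⟩ := hdvd
  refine ⟨r, right_ne_zero_of_mul hg, hZ, ?_⟩
  rw [← Ideal.span_singleton_mul_span_singleton] at hspan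
  exact mul_left_cancel₀ (by simpa using hh) hspan

/-- There is a nonzero regular function with a pole of order at most `n` at infinity and a zero of
order at least `j` at `(0, -b)`. -/
def HasFunction (f : k[X]) {b : k} (hb : b ^ 2 = f.eval 0) (j n : ℕ) : Prop :=
  ∃ g : CoordRing f, g ≠ 0 ∧ poleOrder f g ≤ n ∧
    g ∈ maxIdeal f 0 (-b) (by rw [neg_sq, hb]) ^ j

lemma HasFunction.le (hf : Odd f.natDegree) (hsep : f.Separable) {b : k}
    {hb : b ^ 2 = f.eval 0} {j n : ℕ} (h : HasFunction f hb j n) : j ≤ n := by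
  classical
  obtain ⟨g, hg, hn, hj⟩ := h
  obtain ⟨Z, hZ⟩ := exists_isZeros hf hsep hg
  rw [← hZ.card_eq hf hsep hg] at hn
  rw [hZ.mem_pow_iff hf hsep] at hj
  exact hj.trans ((Multiset.count_le_card _ _).trans hn)

/-- As -[p - q] = [p̄ - q], an effective E represents j[p - q] exactly when j p̄ + E is the divisor
of zeros of a regular function; the pole order of that function is j + deg E. -/
lemma nsmul_pointClass_mem_Theta_iff (hf : Odd f.natDegree) (hsep : f.Separable) {b : k}
    (hb : b ^ 2 = f.eval 0) (j m : ℕ) :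
    j • pointClass (Point.affine (f := f) 0 b hb) ∈ Theta f m ↔ HasFunction f hb j (j + m) := by
  classical
  set P := Point.affine (f := f) 0 b hb with hP
  have hconj := pointClass_conj hf hsep P
  have hcard : ∀ E : Multiset (Point f), ((Multiset.replicate j P.conj + E).map pointClass).sum =
      -(j • pointClass P) + (E.map pointClass).sum := by
    intro E
    rw [Multiset.map_add, Multiset.sum_add, Multiset.map_replicate, Multiset.sum_replicate,
      hconj, neg_nsmul]
  rw [mem_Theta_iff]
  constructor
  · rintro ⟨E, hE, hc, hsum⟩
    have hinf : Point.infinity ∉ Multiset.replicate j P.conj + E := by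
      rw [Multiset.mem_add]
      rintro (h | h)
      · cases Multiset.eq_of_mem_replicate h
      · exact hE h
    obtain ⟨g, hg, hZ⟩ := exists_isZeros_of_sum_eq_zero hf hsep hinf (by
      rw [hcard, hsum, neg_add_cancel])
    refine ⟨g, hg, ?_, ?_⟩
    · rw [← hZ.card_eq hf hsep hg, Multiset.card_add, Multiset.card_replicate]
      omega
    · rw [hZ.mem_pow_iff hf hsep, Multiset.count_add]
      refine le_add_right ?_
      exact (Multiset.count_replicate_self _ _).ge
  · rintro ⟨g, hg, hn, hj⟩
    obtain ⟨Z, hZ⟩ := exists_isZeros hf hsep hg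
    rw [hZ.mem_pow_iff hf hsep, Multiset.le_count_iff_replicate_le] at hj
    obtain ⟨E, rfl⟩ := Multiset.le_iff_exists_add.1 hj
    have hsum := hZ.sum_pointClass hf hsep hg
    rw [← hZ.card_eq hf hsep hg, Multiset.card_add, Multiset.card_replicate] at hn
    refine ⟨E, fun h ↦ hZ.1 (Multiset.mem_add.2 (Or.inr h)), by omega, ?_⟩
    have := hcard E
    change Multiset.sum (Multiset.map pointClass (Multiset.replicate j P.conj + E)) = 0 at hsum
    rw [hsum] at this
    exact (neg_add_eq_zero.1 this.symm).symm

end Jacobian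
-- The Padé problem, Hankel determinants, plateaus and peaks
section Functions

variable {k : Type*} [Field k] {f : k[X]} {γ : ℕ}

/-- Strict degree bounds are used so that they count the free coefficients of u and v. For n ≤ 2γ
the second bound is 0, which forces v = 0. -/
lemma poleOrder_elt_le_iff (hdeg : f.natDegree = 2 * γ + 1) (u v : k[X]) (n : ℕ) :
    poleOrder f (elt f u v) ≤ n ↔
      u.degree < ((n / 2 + 1 : ℕ) : WithBot ℕ) ∧
        v.degree < (((n + 1 - 2 * γ) / 2 : ℕ) : WithBot ℕ) := by
  rw [poleOrder, coord_elt_zero, coord_elt_one, max_le_iff, hdeg]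
  apply and_congr
  · by_cases hu : u = 0
    · simp [hu]
    · rw [← natDegree_lt_iff_degree_lt hu]; omega
  · by_cases hv : v = 0
    · simp [hv]
    · rw [← natDegree_lt_iff_degree_lt hv, if_neg hv]; omega

lemma poleOrder_conj (g : CoordRing f) : poleOrder f (conj f g) = poleOrder f g := by
  obtain ⟨u, v, rfl⟩ := exists_elt g
  rw [conj_elt, poleOrder, poleOrder, coord_elt_zero, coord_elt_zero, coord_elt_one, coord_elt_one]
  by_cases hv : v = 0 <;> simp [hv]

/-- The coefficient of a regular function at the monomial `x ^ i` or `x ^ i y` with a pole of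
order `n`. -/
noncomputable def leadCoeffAt (f : k[X]) (γ n : ℕ) (g : CoordRing f) : k :=
  if Even n then (coord f g 0).coeff (n / 2) else (coord f g 1).coeff (n / 2 - γ)

lemma poleOrder_le_of_leadCoeffAt_eq_zero (hdeg : f.natDegree = 2 * γ + 1) {g : CoordRing f}
    {n : ℕ} (hg : poleOrder f g ≤ n + 1) (h0 : leadCoeffAt f γ (n + 1) g = 0) :
    poleOrder f g ≤ n := by
  obtain ⟨u, v, rfl⟩ := exists_elt g
  rw [poleOrder_elt_le_iff hdeg, degree_lt_iff_coeff_zero, degree_lt_iff_coeff_zero] at *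
  rw [leadCoeffAt, coord_elt_zero, coord_elt_one] at h0
  obtain ⟨hu, hv⟩ := hg
  rcases Nat.even_or_odd (n + 1) with he | ho
  · rw [if_pos he] at h0
    obtain ⟨m, hm⟩ := he
    refine ⟨fun i hi ↦ ?_, fun i hi ↦ hv i (by omega)⟩
    rcases eq_or_ne i ((n + 1) / 2) with rfl | hne
    · exact h0
    · exact hu i (by omega)
  -- When n + 1 < 2γ + 1 the truncated index is 0, which is harmless because `hv` already says v =
  -- 0.
  · rw [if_neg (Nat.not_even_iff_odd.2 ho)] at h0
    obtain ⟨m, hm⟩ := ho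
    refine ⟨fun i hi ↦ hu i (by omega), fun i hi ↦ ?_⟩
    rcases eq_or_ne i ((n + 1) / 2 - γ) with rfl | hne
    · exact h0
    · exact hv i (by omega)

/-- Distinct monomials x^i and x^i y have distinct pole orders, so leading terms of equal pole order
are proportional. -/
lemma exists_poleOrder_sub_le (hdeg : f.natDegree = 2 * γ + 1) {g h : CoordRing f} {n : ℕ}
    (hg : poleOrder f g = n + 1) (hh : poleOrder f h = n + 1) :
    ∃ c : k, c ≠ 0 ∧ poleOrder f (g - elt f (C c) 0 * h) ≤ n := by
  have key : ∀ g : CoordRing f, poleOrder f g = n + 1 → leadCoeffAt f γ (n + 1) g ≠ 0 := by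
    intro g hg h0
    have := poleOrder_le_of_leadCoeffAt_eq_zero hdeg hg.le h0
    omega
  refine ⟨leadCoeffAt f γ (n + 1) g / leadCoeffAt f γ (n + 1) h,
    div_ne_zero (key g hg) (key h hh), ?_⟩
  have hh0 := key h hh
  set c := leadCoeffAt f γ (n + 1) g / leadCoeffAt f γ (n + 1) h with hc
  have hc' : leadCoeffAt f γ (n + 1) g - c * leadCoeffAt f γ (n + 1) h = 0 := by
    rw [hc, div_mul_cancel₀ _ hh0, sub_self]
  clear_value c
  obtain ⟨u, v, rfl⟩ := exists_elt g
  obtain ⟨u', v', rfl⟩ := exists_elt h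
  apply poleOrder_le_of_leadCoeffAt_eq_zero hdeg
  · have hg' := hg.le
    have hh' := hh.le
    rw [elt_mul, elt_sub]
    rw [poleOrder_elt_le_iff hdeg, degree_lt_iff_coeff_zero, degree_lt_iff_coeff_zero] at *
    refine ⟨fun i hi ↦ ?_, fun i hi ↦ ?_⟩
    · simp [hg'.1 i hi, hh'.1 i hi]
    · simp [hg'.2 i hi, hh'.2 i hi]
  · rw [← hc', elt_mul, elt_sub]
    simp only [leadCoeffAt, coord_elt_zero, coord_elt_one]
    split_ifs <;> simp

lemma HasFunction.mono {b : k} {hb : b ^ 2 = f.eval 0} {j n n' : ℕ} (hn : n ≤ n')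
    (h : HasFunction f hb j n) : HasFunction f hb j n' := by
  obtain ⟨g, hg, hp, hm⟩ := h
  exact ⟨g, hg, hp.trans hn, hm⟩

lemma poleOrder_eq_of_minimal {b : k} {hb : b ^ 2 = f.eval 0} {j n : ℕ} {g : CoordRing f}
    (hg : g ≠ 0) (hp : poleOrder f g ≤ n)
    (hm : g ∈ maxIdeal f 0 (-b) (by rw [neg_sq, hb]) ^ j)
    (hmin : ∀ n' < n, ¬ HasFunction f hb j n') : poleOrder f g = n := by
  by_contra h
  exact hmin _ (lt_of_le_of_ne hp h) ⟨g, hg, le_rfl, hm⟩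

/-- Approximate square roots of `f` at `x = 0`. -/
lemma exists_sqrt_approx [NeZero (2 : k)] {b : k} (hb0 : b ≠ 0) (hb : b ^ 2 = f.eval 0) (j : ℕ) :
    ∃ t : k[X], X ^ j ∣ t ^ 2 - f ∧ t.eval 0 = b := by
  have key : ∀ j, ∃ t : k[X], X ^ (j + 1) ∣ t ^ 2 - f ∧ t.eval 0 = b := by
    intro j
    induction j with
    | zero =>
      refine ⟨C b, ?_, by simp⟩
      rw [zero_add, pow_one, X_dvd_iff, coeff_zero_eq_eval_zero]
      simp [hb]
    | succ j ih =>
      obtain ⟨t, ⟨r, hr⟩, ht⟩ := ih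
      -- The Newton correction: c cancels the coefficient of x^(j+1) in t² - f.
      set c := -r.eval 0 / (2 * b) with hc
      have hc' : r.eval 0 + 2 * c * b = 0 := by
        rw [hc]; field_simp [two_ne_zero (α := k)]; ring
      refine ⟨t + C c * X ^ (j + 1), ?_, by simp [ht]⟩
      have hX : (X : k[X]) ∣ r + 2 * C c * t + C c ^ 2 * X ^ (j + 1) := by
        rw [X_dvd_iff, coeff_zero_eq_eval_zero]
        simpa [ht] using hc'
      have : (t + C c * X ^ (j + 1)) ^ 2 - f =
          X ^ (j + 1) * (r + 2 * C c * t + C c ^ 2 * X ^ (j + 1)) := by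
        linear_combination hr
      rw [this, pow_succ X (j + 1)]
      exact mul_dvd_mul_left _ hX
  obtain ⟨t, h1, h2⟩ := key j
  exact ⟨t, (pow_dvd_pow _ (Nat.le_succ j)).trans h1, h2⟩

/-- The coefficients of a product form a Toeplitz system; reversing the order of the coefficients of
v makes the matrix Hankel. -/
lemma coeff_mul_eq_mulVec_rev {B j A : ℕ} (hAB : B ≤ A) {s : PowerSeries k} {t v : k[X]}
    (hts : ∀ i < j, t.coeff i = PowerSeries.coeff i s)
    (hv : v.degree < (B : WithBot ℕ)) (i : Fin B) (hi : A + i < j) :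
    (v * t).coeff (A + i) = ((Matrix.of fun i l : Fin B ↦
      PowerSeries.coeff (A + 1 - B + (i : ℕ) + (l : ℕ)) s).mulVec
        fun l ↦ v.coeff (Fin.rev l)) i := by
  rw [Matrix.mulVec, dotProduct, ← Equiv.sum_comp Fin.revPerm]
  simp only [Fin.revPerm_apply, Fin.rev_rev, Matrix.of_apply]
  have hvs : v = ∑ l : Fin B, C (v.coeff l) * X ^ (l : ℕ) := by
    rw [Fin.sum_univ_eq_sum_range (fun l ↦ C (v.coeff l) * X ^ l) B]
    by_cases h0 : v = 0
    · simp [h0]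
    · exact v.as_sum_range_C_mul_X_pow' ((natDegree_lt_iff_degree_lt h0).2 hv)
  conv_lhs => rw [hvs, Finset.sum_mul, finsetSum_coeff]
  refine Finset.sum_congr rfl fun l _ ↦ ?_
  have hl := l.2
  rw [mul_assoc, coeff_C_mul, mul_comm (X ^ _) t, coeff_mul_X_pow', if_pos (by omega),
    hts _ (by omega), mul_comm, Fin.val_rev]
  congr 3
  omega

variable [NeZero (2 : k)]

/-- A polynomial in x is fixed by the involution, so it lies in the j-th powers of both conjugate
maximal ideals. These are coprime as c ≠ 0, and the product of the two maximal ideals is (x). -/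
lemma of_mem_pow_iff (hsep : f.Separable) {c : k} (hc0 : c ≠ 0)
    (hc : c ^ 2 = f.eval 0) (d : k[X]) (j : ℕ) :
    AdjoinRoot.of ((X : k[X][X]) ^ 2 - C f) d ∈ maxIdeal f 0 c hc ^ j ↔ X ^ j ∣ d := by
  have hc' : (-c) ^ 2 = f.eval 0 := by rw [neg_sq, hc]
  constructor
  · intro h
    have h' : AdjoinRoot.of ((X : k[X][X]) ^ 2 - C f) d ∈ maxIdeal f 0 (-c) hc' ^ j := by
      have := Ideal.mem_map_of_mem (conj f) h
      rwa [Ideal.map_pow, map_conj_maxIdeal hc hc', of_eq_elt, conj_elt, neg_zero,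
        ← of_eq_elt] at this
    have hne : maxIdeal f 0 c hc ≠ maxIdeal f 0 (-c) hc' := by
      intro he
      have h1 : elt f (-C c) 1 ∈ maxIdeal f 0 c hc := by simp [mem_maxIdeal]
      rw [he, mem_maxIdeal] at h1
      have : (2 : k) * c = 0 := by
        have : -c + -c = 0 := by simpa using h1
        linear_combination -this
      exact mul_ne_zero two_ne_zero hc0 this
    have hcop : IsCoprime (maxIdeal f 0 c hc ^ j) (maxIdeal f 0 (-c) hc' ^ j) := by
      apply IsCoprime.pow
      rw [Ideal.isCoprime_iff_sup_eq]
      exact (maxIdeal_isMaximal hc).coprime_of_ne (maxIdeal_isMaximal hc') hne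
    have h2 := Ideal.mem_inf.2 ⟨h, h'⟩
    have h3 := (isZeros_X_sub_C hsep hc).2
    change _ = (Multiset.map idealOf (Point.affine 0 c hc ::ₘ {Point.affine 0 (-c) hc'})).prod at h3
    simp only [Multiset.map_cons, Multiset.map_singleton, Multiset.prod_cons,
      Multiset.prod_singleton, idealOf, C_0, sub_zero] at h3
    rw [← Ideal.mul_eq_inf_of_coprime (Ideal.isCoprime_iff_sup_eq.1 hcop), ← mul_pow, ← h3,
      Ideal.span_singleton_pow, Ideal.mem_span_singleton, ← of_eq_elt, ← map_pow] at h2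
    obtain ⟨r, hr⟩ := h2
    obtain ⟨u, v, rfl⟩ := exists_elt r
    rw [of_eq_elt, of_eq_elt, elt_mul, elt_inj] at hr
    exact ⟨u, by simpa using hr.1⟩
  · rintro ⟨e, rfl⟩
    rw [map_mul, map_pow]
    refine Ideal.mul_mem_right _ _ (Ideal.pow_mem_pow ?_ _)
    rw [of_eq_elt, mem_maxIdeal]
    simp

/-- The product of g with the conjugate of h has odd pole order 2n + 1, so its y-coefficient is
nonzero of degree n - γ < j. But that coefficient is a determinant in the coordinates of g and h,
divisible by x^j. -/
lemma not_plateau (hdeg : f.natDegree = 2 * γ + 1) (hsep : f.Separable) {b : k}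
    (hb0 : b ≠ 0) (hb : b ^ 2 = f.eval 0) {j n : ℕ} (hn : n < j + γ)
    (h1 : HasFunction f hb j n) (h1' : ∀ n' < n, ¬ HasFunction f hb j n')
    (h2 : HasFunction f hb (j + 1) (n + 1))
    (h2' : ∀ n' < n + 1, ¬ HasFunction f hb (j + 1) n') : False := by
  have hf : Odd f.natDegree := ⟨γ, hdeg⟩
  have := isDomain_coordRing hf
  obtain ⟨g, hg, hgn, hgm⟩ := h1
  obtain ⟨h, hh, hhn, hhm⟩ := h2
  have hgp := poleOrder_eq_of_minimal hg hgn hgm h1'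
  have hhp := poleOrder_eq_of_minimal hh hhn hhm h2'
  have hch : conj f h ≠ 0 := fun h0 ↦ hh (by rw [← conj_conj h, h0, map_zero])
  have hprod := poleOrder_mul hf hg hch
  rw [poleOrder_conj, hgp, hhp] at hprod
  have hhm' := Ideal.pow_le_pow_right (Nat.le_succ j) hhm
  obtain ⟨u, v, rfl⟩ := exists_elt g
  obtain ⟨u', v', rfl⟩ := exists_elt h
  rw [conj_elt, elt_mul, poleOrder, coord_elt_zero, coord_elt_one, hdeg] at hprod
  have hdvd : X ^ j ∣ u * -v' + v * u' := by
    rw [← of_mem_pow_iff hsep (neg_ne_zero.2 hb0) (by rw [neg_sq, hb])]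
    have : AdjoinRoot.of _ (u * -v' + v * u') = elt f v 0 * elt f u' v' - elt f v' 0 * elt f u v := by
      rw [of_eq_elt, elt_mul, elt_mul, elt_sub, elt_inj]
      constructor <;> ring
    rw [this]
    exact Ideal.sub_mem _ (Ideal.mul_mem_left _ _ hhm') (Ideal.mul_mem_left _ _ hgm)
  split_ifs at hprod with h0
  · omega
  · have := natDegree_le_of_dvd hdvd h0
    rw [natDegree_X_pow] at this
    omega

variable [IsAlgClosed k]

/-- Modulo the j-th power of the ideal of p̄ one has y ≡ -t: the product (y - t)(y + t) = f - t²
vanishes to order j, and y - t takes the value -2b ≠ 0 at p̄. -/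
lemma elt_mem_pow_iff (hf : Odd f.natDegree) (hsep : f.Separable) {b : k} (hb0 : b ≠ 0)
    (hb' : (-b) ^ 2 = f.eval 0) {j : ℕ} {t : k[X]}
    (ht : X ^ j ∣ t ^ 2 - f) (ht0 : t.eval 0 = b) (u v : k[X]) :
    elt f u v ∈ maxIdeal f 0 (-b) hb' ^ j ↔ X ^ j ∣ u - v * t := by
  have := isDedekindDomain_coordRing hf hsep
  have hp := (maxIdeal_isMaximal hb').isPrime
  have hmem : elt f t 1 ∈ maxIdeal f 0 (-b) hb' ^ j := by
    have h1 : elt f (-t) 1 * elt f t 1 ∈ maxIdeal f 0 (-b) hb' ^ j := by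
      have : elt f (-t) 1 * elt f t 1 = AdjoinRoot.of _ (-(t ^ 2 - f)) := by
        rw [elt_mul, of_eq_elt, elt_inj]
        constructor <;> ring
      rw [this, of_mem_pow_iff hsep (neg_ne_zero.2 hb0)]
      exact (dvd_neg).2 ht
    refine (Ideal.IsPrime.mul_mem_pow _ h1).resolve_left ?_
    rw [mem_maxIdeal, eval_neg, ht0, eval_one, one_mul]
    intro h
    exact mul_ne_zero two_ne_zero hb0 (by linear_combination -h : (2 : k) * b = 0)
  rw [← of_mem_pow_iff hsep (neg_ne_zero.2 hb0) hb']
  have e : elt f u v = AdjoinRoot.of _ (u - v * t) + elt f v 0 * elt f t 1 := by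
    rw [elt_mul, of_eq_elt, elt_add, elt_inj]
    constructor <;> ring
  rw [e]
  exact Ideal.add_mem_iff_left _ (Ideal.mul_mem_left _ _ hmem)

lemma hasFunction_iff (hdeg : f.natDegree = 2 * γ + 1) (hsep : f.Separable) {b : k}
    (hb0 : b ≠ 0) (hb : b ^ 2 = f.eval 0) {j : ℕ} {t : k[X]}
    (ht : X ^ j ∣ t ^ 2 - f) (ht0 : t.eval 0 = b) (n : ℕ) :
    HasFunction f hb j n ↔ ∃ u v : k[X], (u ≠ 0 ∨ v ≠ 0) ∧
      u.degree < ((n / 2 + 1 : ℕ) : WithBot ℕ) ∧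
        v.degree < (((n + 1 - 2 * γ) / 2 : ℕ) : WithBot ℕ) ∧ X ^ j ∣ u - v * t := by
  have hf : Odd f.natDegree := ⟨γ, hdeg⟩
  constructor
  · rintro ⟨g, hg, hp, hm⟩
    obtain ⟨u, v, rfl⟩ := exists_elt g
    rw [elt_mem_pow_iff hf hsep hb0 _ ht ht0] at hm
    rw [poleOrder_elt_le_iff hdeg] at hp
    exact ⟨u, v, elt_ne_zero.1 hg, hp.1, hp.2, hm⟩
  · rintro ⟨u, v, hg, h1, h2, hm⟩
    refine ⟨elt f u v, elt_ne_zero.2 hg, (poleOrder_elt_le_iff hdeg _ _ _).2 ⟨h1, h2⟩, ?_⟩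
    rwa [elt_mem_pow_iff hf hsep hb0 _ ht ht0]

/-- A dimension count: u and v have A + B ≥ j + 1 coefficients in total, subject to j linear
conditions. -/
lemma hasFunction_add_genus (hdeg : f.natDegree = 2 * γ + 1) (hsep : f.Separable) {b : k}
    (hb0 : b ≠ 0) (hb : b ^ 2 = f.eval 0) (j : ℕ) : HasFunction f hb j (j + γ) := by
  obtain ⟨t, ht, ht0⟩ := exists_sqrt_approx hb0 hb j
  rw [hasFunction_iff hdeg hsep hb0 hb ht ht0]
  set A := (j + γ) / 2 + 1 with hA
  set B := (j + γ + 1 - 2 * γ) / 2 with hB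
  let φ : (degreeLT k A × degreeLT k B) →ₗ[k] (Fin j → k) :=
    LinearMap.pi fun i ↦ (lcoeff k i).comp
      ((degreeLT k A).subtype.coprod (-(LinearMap.mulRight k t).comp (degreeLT k B).subtype))
  have hφ : ∀ u v i, φ (u, v) i = ((u : k[X]) - v * t).coeff i := by
    intro u v i
    simp [φ, sub_eq_add_neg]
  have hA' : Module.finrank k (degreeLT k A) = A := by
    rw [(degreeLTEquiv k A).finrank_eq]; simp
  have hB' : Module.finrank k (degreeLT k B) = B := by
    rw [(degreeLTEquiv k B).finrank_eq]; simp
  have : Module.Finite k (degreeLT k A) := Module.Finite.equiv (degreeLTEquiv k A).symm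
  have : Module.Finite k (degreeLT k B) := Module.Finite.equiv (degreeLTEquiv k B).symm
  have hker : LinearMap.ker φ ≠ ⊥ := by
    apply LinearMap.ker_ne_bot_of_finrank_lt
    rw [Module.finrank_prod, hA', hB', Module.finrank_fin_fun]
    omega
  obtain ⟨⟨u, v⟩, hw, hne⟩ := Submodule.exists_mem_ne_zero_of_ne_bot hker
  refine ⟨u, v, ?_, mem_degreeLT.1 u.2, mem_degreeLT.1 v.2, ?_⟩
  · by_contra! h
    exact hne (Prod.ext (Subtype.ext h.1) (Subtype.ext h.2))
  · rw [X_pow_dvd_iff]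
    intro d hd
    rw [LinearMap.mem_ker] at hw
    have := congrFun hw ⟨d, hd⟩
    rw [hφ] at this
    exact this

/-- Both x g and h have pole order n + 2 and vanish to order at least j + 1 at p̄; cancelling
leading terms gives the function sought. -/
lemma hasFunction_of_peak (hdeg : f.natDegree = 2 * γ + 1) (hsep : f.Separable) {b : k}
    (hb0 : b ≠ 0)
    (hb : b ^ 2 = f.eval 0) {j n : ℕ}
    (h1 : HasFunction f hb j n) (h1' : ∀ n' < n, ¬ HasFunction f hb j n')
    (h2 : HasFunction f hb (j + 2) (n + 2))
    (h2' : ∀ n' < n + 2, ¬ HasFunction f hb (j + 2) n') : HasFunction f hb (j + 1) (n + 1) := by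
  classical
  have hf : Odd f.natDegree := ⟨γ, hdeg⟩
  have := isDomain_coordRing hf
  obtain ⟨g, hg, hgn, hgm⟩ := h1
  obtain ⟨h, hh, hhn, hhm⟩ := h2
  have hgp := poleOrder_eq_of_minimal hg hgn hgm h1'
  have hhp := poleOrder_eq_of_minimal hh hhn hhm h2'
  have hX : elt f X 0 ≠ 0 := elt_ne_zero.2 (Or.inl X_ne_zero)
  have hXm : elt f X 0 ∈ maxIdeal f 0 (-b) (by rw [neg_sq, hb]) := by simp [mem_maxIdeal]
  have hxg : poleOrder f (elt f X 0 * g) = n + 1 + 1 := by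
    rw [poleOrder_mul hf hX hg, hgp]
    simp [poleOrder]; omega
  obtain ⟨c, hc, hle⟩ := exists_poleOrder_sub_le hdeg hxg hhp
  have hmem : elt f X 0 * g ∈ maxIdeal f 0 (-b) (by rw [neg_sq, hb]) ^ (j + 1) := by
    exact (pow_succ' (maxIdeal f 0 (-b) _) j).symm ▸ Ideal.mul_mem_mul hXm hgm
  -- If the difference vanishes, x g = c h; as x has only a simple zero at p̄, g itself vanishes to
  -- order j + 1.
  by_cases h0 : elt f X 0 * g - elt f (C c) 0 * h = 0
  · have hb' : (-b) ^ 2 = f.eval 0 := by rw [neg_sq, hb]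
    have hgm' : g ∈ maxIdeal f 0 (-b) hb' ^ (j + 1) := by
      have hcz : elt f (C c) 0 ≠ 0 := elt_ne_zero.2 (Or.inl (C_ne_zero.2 hc))
      obtain ⟨G, hG⟩ := exists_isZeros hf hsep hg
      obtain ⟨H, hH⟩ := exists_isZeros hf hsep hh
      have hx := isZeros_X_sub_C hsep hb'
      rw [C_0, sub_zero] at hx
      have e := (hx.mul hG).unique hf hsep
        ((sub_eq_zero.1 h0).symm ▸ (isZeros_C (f := f) hc).mul hH)
      rw [hH.mem_pow_iff hf hsep] at hhm
      rw [hG.mem_pow_iff hf hsep]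
      rw [zero_add] at e
      rw [← e, Multiset.count_add] at hhm
      have hcount : Multiset.count (Point.affine 0 (-b) hb')
          {Point.affine 0 (-b) hb', (Point.affine 0 (-b) hb').conj} = 1 := by
        change Multiset.count (Point.affine 0 (-b) hb')
          (Point.affine 0 (-b) hb' ::ₘ {(Point.affine 0 (-b) hb').conj}) = 1
        rw [Multiset.count_cons_self, Multiset.count_singleton, if_neg]
        intro he
        rw [Point.conj] at he
        have h3 : -b = -(-b) := (Point.affine.injEq ..).mp he |>.2
        exact mul_ne_zero two_ne_zero hb0 (by linear_combination -h3 : (2 : k) * b = 0)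
      omega
    exact ⟨g, hg, by omega, hgm'⟩
  · exact ⟨_, h0, hle, Ideal.sub_mem _ hmem
      (Ideal.mul_mem_left _ _ (Ideal.pow_le_pow_right (by omega) hhm))⟩

/-- The Hankel criterion for a function with a smaller pole than expected. -/
lemma hasFunction_iff_hankelDet (hdeg : f.natDegree = 2 * γ + 1) (hsep : f.Separable) {b : k}
    (hb0 : b ≠ 0) (hb : b ^ 2 = f.eval 0) {s : PowerSeries k}
    (hs : s ^ 2 = (f : PowerSeries k)) (hsb : PowerSeries.constantCoeff s = b) {j : ℕ}
    (hj : γ + 1 ≤ j) :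
    HasFunction f hb j (j + γ - 1) ↔ hankelDet γ (fun i ↦ PowerSeries.coeff i s) j = 0 := by
  set t := PowerSeries.trunc j s with htdef
  have hts : ∀ i < j, t.coeff i = PowerSeries.coeff i s := fun i hi ↦ by
    rw [htdef, PowerSeries.coeff_trunc, if_pos hi]
  have ht0 : t.eval 0 = b := by
    rw [← coeff_zero_eq_eval_zero, hts 0 (by omega), ← hsb, PowerSeries.coeff_zero_eq_constantCoeff]
  have ht : X ^ j ∣ t ^ 2 - f := by
    have h1 : (PowerSeries.X : PowerSeries k) ^ j ∣ (t : PowerSeries k) - s := by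
      rw [PowerSeries.X_pow_dvd_iff]
      intro i hi
      rw [map_sub, coeff_coe, hts i hi, sub_self]
    have h2 : (PowerSeries.X : PowerSeries k) ^ j ∣ ((t ^ 2 - f : k[X]) : PowerSeries k) := by
      rw [coe_sub, coe_pow, ← hs, sq_sub_sq]
      exact h1.mul_left _
    rw [X_pow_dvd_iff]
    rw [PowerSeries.X_pow_dvd_iff] at h2
    intro i hi
    rw [← coeff_coe]
    exact h2 i hi
  -- Now A + B = j: u absorbs the coefficients of v t below x^A, leaving B equations in the B
  -- coefficients of v.
  set B := (j - γ) / 2 with hB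
  set A := j - B with hA
  have hA1 : (j + γ - 1) / 2 + 1 = A := by omega
  have hB1 : (j + γ - 1 + 1 - 2 * γ) / 2 = B := by omega
  set M := (Matrix.of fun i l : Fin B ↦
      PowerSeries.coeff (A + 1 - B + (i : ℕ) + (l : ℕ)) s) with hM
  have hdet : hankelDet γ (fun i ↦ PowerSeries.coeff i s) j = M.det := by
    rw [hankelDet]
    split_ifs with ho
    · obtain ⟨r, hr⟩ := ho
      have e1 : (j - γ - 1) / 2 = B := by omega
      have e2 : γ + 2 = A + 1 - B := by omega
      rw [e1, e2]
    · rw [Nat.not_odd_iff_even] at ho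
      obtain ⟨r, hr⟩ := ho
      have e2 : γ + 1 = A + 1 - B := by omega
      rw [e2]
  rw [hdet, ← Matrix.exists_mulVec_eq_zero_iff, hasFunction_iff hdeg hsep hb0 hb ht ht0, hA1, hB1]
  have hcoeff : ∀ v : k[X], v.degree < (B : WithBot ℕ) → ∀ i : Fin B,
      (v * t).coeff (A + i) = (M.mulVec fun l ↦ v.coeff (Fin.rev l)) i :=
    fun v hv i ↦ coeff_mul_eq_mulVec_rev (by omega) hts hv i (by omega)
  constructor
  · rintro ⟨u, v, hne, hu, hv, hd⟩
    rw [X_pow_dvd_iff] at hd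
    rw [degree_lt_iff_coeff_zero] at hu
    have hv0 : v ≠ 0 := by
      rintro rfl
      refine hne.elim (fun h ↦ h ?_) (fun h ↦ h rfl)
      ext i
      by_cases hi : i < j
      · simpa using hd i hi
      · exact hu i (by omega)
    refine ⟨fun l ↦ v.coeff (Fin.rev l), fun h0 ↦ hv0 ?_, ?_⟩
    · ext i
      by_cases hi : i < B
      · have := congrFun h0 (Fin.rev ⟨i, hi⟩)
        simpa only [Fin.rev_rev, Pi.zero_apply, coeff_zero] using this
      · exact (degree_lt_iff_coeff_zero _ _).1 hv i (by omega)
    · ext i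
      rw [← hcoeff v hv i, Pi.zero_apply]
      have := hd (A + i) (by omega)
      rw [coeff_sub, hu _ (by omega), zero_sub, neg_eq_zero] at this
      exact this
  · rintro ⟨w, hw0, hw⟩
    set v := ((degreeLTEquiv k B).symm fun l ↦ w (Fin.rev l)) with hvdef
    have hvc : ∀ l : Fin B, (v : k[X]).coeff (Fin.rev l) = w l := by
      intro l
      have : (degreeLTEquiv k B) v (Fin.rev l) = w l := by
        rw [hvdef, LinearEquiv.apply_symm_apply, Fin.rev_rev]
      exact this
    have hvd := mem_degreeLT.1 v.2
    refine ⟨PowerSeries.trunc A ((v * t : k[X]) : PowerSeries k), v, Or.inr fun h0 ↦ hw0 ?_,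
      PowerSeries.degree_trunc_lt _ _, hvd, ?_⟩
    · ext l
      rw [← hvc l, h0, coeff_zero, Pi.zero_apply]
    · rw [X_pow_dvd_iff]
      intro i hi
      rw [coeff_sub, PowerSeries.coeff_trunc, coeff_coe]
      split_ifs with hiA
      · exact sub_self _
      · have := hcoeff v hvd ⟨i - A, by omega⟩
        simp only [hvc] at this
        rw [hw, Pi.zero_apply, Nat.add_sub_cancel' (by omega)] at this
        rw [this, sub_zero]

end Functions
-- Combinatorics of admissible sequences
section Profiles

/-- The conditions on a sequence of order `N` that determine it from its small range. -/
structure ProfileLike (γ N : ℕ) (e : ℕ → ℕ) : Prop where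
  one : e 1 = 1
  le_genus : ∀ j, 1 ≤ j → e j ≤ γ
  periodic : ∀ j, 1 ≤ j → e (j + N) = e j
  symmetric : ∀ j, 1 ≤ j → j < N → e (N - j) = e j
  eq_zero : e N = 0
  succ_le : ∀ j, 1 ≤ j → e (j + 1) ≤ e j + 1
  le_succ : ∀ j, 1 ≤ j → e j ≤ e (j + 1) + 1
  no_peak : ∀ j a, 1 ≤ j → ¬(e j = a ∧ e (j + 1) = a + 1 ∧ e (j + 2) = a)
  no_plateau : ∀ j a, 1 ≤ j → a < γ → ¬(e j = a ∧ e (j + 1) = a)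

lemma NecessaryConditions.profileLike {γ N : ℕ} {e : ℕ → ℕ} (hN : 0 < N)
    (h : NecessaryConditions γ N e) : ProfileLike γ N e where
  one := h.one
  le_genus := h.le_genus
  periodic := h.periodic
  symmetric := h.symmetric
  eq_zero := (h.eq_zero_iff N hN).2 dvd_rfl
  succ_le j hj := by
    have := h.subadditive j 1 hj le_rfl
    rwa [h.one] at this
  le_succ j hj := by
    have hN1 : N ≠ 1 := by
      rintro rfl
      have := (h.eq_zero_iff 1 le_rfl).2 dvd_rfl
      rw [h.one] at this
      exact one_ne_zero this
    -- Stepping back by 1 is adding N - 1, and the entry at N - 1 is 1 by symmetry.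
    have h1 := h.subadditive (j + 1) (N - 1) (by omega) (by omega)
    rw [h.symmetric 1 le_rfl (by omega), h.one, show j + 1 + (N - 1) = j + N by omega,
      h.periodic j hj] at h1
    exact h1
  no_peak := h.no_peak
  no_plateau := h.no_plateau

namespace ProfileLike

variable {γ N : ℕ} {e e' : ℕ → ℕ}

/-- If all three entries are at most a and the middle one equals a, then the absence of plateaus
makes both neighbours a - 1, a forbidden peak. The converse holds because steps are at most 1. -/
lemma le_pred_iff (h : ProfileLike γ N e) {a j : ℕ} (ha : 1 ≤ a) (haγ : a < γ) (hj : 1 ≤ j) :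
    e (j + 1) ≤ a - 1 ↔ e j ≤ a ∧ e (j + 1) ≤ a ∧ e (j + 2) ≤ a := by
  have h1 := h.succ_le j hj
  have h2 := h.le_succ j hj
  have h3 := h.succ_le (j + 1) (by omega)
  have h4 := h.le_succ (j + 1) (by omega)
  have h5 := h.no_peak j (a - 1) hj
  have h6 := h.no_plateau j a hj haγ
  have h7 := h.no_plateau (j + 1) a (by omega) haγ
  rw [show j + 1 + 1 = j + 2 by omega] at *
  omega

/-- A sequence is determined by the places where it is not maximal. -/
lemma eq_of_lt_iff (h : ProfileLike γ N e) (h' : ProfileLike γ N e') (hN : 0 < N)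
    (heq : ∀ j, 1 ≤ j → (e j < γ ↔ e' j < γ)) : ∀ j, 1 ≤ j → e j = e' j := by
  -- Descent through the sublevel sets, from level γ - 1 down to 0.
  have key : ∀ d, d + 1 ≤ γ → ∀ j, 1 ≤ j → (e j ≤ γ - 1 - d ↔ e' j ≤ γ - 1 - d) := by
    intro d
    induction d with
    | zero =>
      intro hd j hj
      have := heq j hj
      omega
    | succ d ih =>
      intro hd j hj
      have ih := ih (by omega)
      have ha : 1 ≤ γ - 1 - d := by omega
      have haγ : γ - 1 - d < γ := by omega
      -- The window is centred at j + N rather than j, so that its left end is a positive index even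
      -- for j = 1.
      have e1 := h.le_pred_iff ha haγ (j := j + N - 1) (by omega)
      have e2 := h'.le_pred_iff ha haγ (j := j + N - 1) (by omega)
      rw [← ih _ (by omega), ← ih _ (by omega), ← ih _ (by omega), ← e1,
        show j + N - 1 + 1 = j + N by omega, h.periodic j hj, h'.periodic j hj] at e2
      rw [show γ - 1 - (d + 1) = γ - 1 - d - 1 by omega]
      exact e2.symm
  intro j hj
  have h1 := h.le_genus j hj
  have h2 := h'.le_genus j hj
  apply le_antisymm
  · rcases h2.lt_or_eq with h3 | h3
    · have := (key (γ - 1 - e' j) (by omega) j hj).2 (by omega)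
      omega
    · omega
  · rcases h1.lt_or_eq with h3 | h3
    · have := (key (γ - 1 - e j) (by omega) j hj).1 (by omega)
      omega
    · omega

lemma eq_self (h : ProfileLike γ N e) (hN : 0 < N) {j : ℕ} (hj : 1 ≤ j) (hjγ : j ≤ γ) :
    e j = j := by
  -- The induction starts at index N, where the entry is 0, since index 0 carries no information.
  -- After j, j + 1 the next entry is not j (peak) nor j + 1 (plateau).
  have key : ∀ j, j + 1 ≤ γ → e (N + j) = j ∧ e (N + j + 1) = j + 1 := by
    intro j
    induction j with
    | zero =>
      intro _
      have := h.periodic 1 le_rfl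
      rw [h.one, add_comm] at this
      exact ⟨h.eq_zero, this⟩
    | succ j ih =>
      intro hjγ
      obtain ⟨h1, h2⟩ := ih (by omega)
      refine ⟨h2, ?_⟩
      have h3 := h.succ_le (N + j + 1) (by omega)
      have h4 := h.le_succ (N + j + 1) (by omega)
      have h5 := h.no_peak (N + j) j (by omega)
      have h6 := h.no_plateau (N + j + 1) (j + 1) (by omega) (by omega)
      rw [← add_assoc]
      rw [show N + j + 1 + 1 = N + j + 2 by omega] at *
      omega
  have := (key (j - 1) (by omega)).2
  rw [show N + (j - 1) + 1 = j + N by omega, h.periodic j hj] at this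
  omega

lemma mod_eq (h : ProfileLike γ N e) {r : ℕ} (hr : 1 ≤ r) (q : ℕ) : e (r + N * q) = e r := by
  induction q with
  | zero => simp
  | succ q ih =>
    rw [mul_add, mul_one, ← add_assoc, h.periodic _ (by omega), ih]

/-- A sequence is determined by the places `γ + 1 ≤ j ≤ N / 2` where it is not maximal. -/
lemma eq_of_lt_iff_of_le_half (h : ProfileLike γ N e) (h' : ProfileLike γ N e') (hN : 0 < N)
    (heq : ∀ j, γ + 1 ≤ j → j ≤ N / 2 → (e j < γ ↔ e' j < γ)) : ∀ j, 1 ≤ j → e j = e' j := by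
  apply h.eq_of_lt_iff h' hN
  have small : ∀ j, 1 ≤ j → j ≤ N / 2 → (e j < γ ↔ e' j < γ) := by
    intro j hj hj2
    by_cases hjγ : j ≤ γ
    · rw [h.eq_self hN hj hjγ, h'.eq_self hN hj hjγ]
    · exact heq j (by omega) hj2
  have period : ∀ j, 1 ≤ j → j ≤ N → (e j < γ ↔ e' j < γ) := by
    intro j hj hjN
    rcases hjN.eq_or_lt with rfl | hlt
    · rw [h.eq_zero, h'.eq_zero]
    · by_cases hj2 : j ≤ N / 2
      · exact small j hj hj2
      · rw [← h.symmetric j hj hlt, ← h'.symmetric j hj hlt]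
        exact small _ (by omega) (by omega)
  intro j hj
  have hdiv := Nat.mod_add_div (j - 1) N
  have hlt := Nat.mod_lt (j - 1) hN
  have e1 : j = ((j - 1) % N + 1) + N * ((j - 1) / N) := by omega
  rw [e1, h.mod_eq (by omega), h'.mod_eq (by omega)]
  exact period _ (by omega) (by omega)

end ProfileLike

end Profiles

/-! ### The multiplication profile of the point class -/

section Multiples

variable {k : Type*} [Field k] {f : k[X]} {γ : ℕ}

lemma mem_ThetaZero_unique {z : Jac f} {d d' : ℕ} (h : z ∈ ThetaZero f d)
    (h' : z ∈ ThetaZero f d') : d = d' := by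
  have key : ∀ d d', z ∈ ThetaZero f d → z ∈ ThetaZero f d' → d ≤ d' := by
    intro d d' h h'
    by_contra! hlt
    obtain ⟨d, rfl⟩ := Nat.exists_eq_succ_of_ne_zero (Nat.ne_zero_of_lt hlt)
    refine h.2 (Theta_mono (Nat.lt_succ_iff.1 hlt) ?_)
    cases d' with
    | zero => exact h'
    | succ d' => exact h'.1
  exact le_antisymm (key _ _ h h') (key _ _ h' h)

lemma mem_ThetaZero_iff {z : Jac f} {d : ℕ} :
    z ∈ ThetaZero f d ↔ z ∈ Theta f d ∧ ∀ d' < d, z ∉ Theta f d' := by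
  cases d with
  | zero => simp [ThetaZero]
  | succ d =>
    refine and_congr_right fun _ ↦ ⟨fun h d' hd hz ↦ h (Theta_mono (by omega) hz),
      fun h ↦ h d (by omega)⟩

lemma Theta_zero_eq : Theta f 0 = {0} := by
  ext z
  simp [Theta]

lemma IsMultProfile.ext {x : Jac f} {e e' : ℕ → ℕ} (h : IsMultProfile x e)
    (h' : IsMultProfile x e') {j : ℕ} (hj : 1 ≤ j) : e j = e' j :=
  mem_ThetaZero_unique (h j hj) (h' j hj)

lemma IsMultProfile.le_of_mem {x : Jac f} {m : ℕ → ℕ} (h : IsMultProfile x m) {j d : ℕ}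
    (hj : 1 ≤ j) (hd : j • x ∈ Theta f d) : m j ≤ d := by
  by_contra! hlt
  exact (mem_ThetaZero_iff.1 (h j hj)).2 d hlt hd

lemma IsMultProfile.mem {x : Jac f} {m : ℕ → ℕ} (h : IsMultProfile x m) {j : ℕ}
    (hj : 1 ≤ j) : j • x ∈ Theta f (m j) := (mem_ThetaZero_iff.1 (h j hj)).1

variable [IsAlgClosed k] [NeZero (2 : k)]

lemma nsmul_mem_ThetaZero_iff (hf : Odd f.natDegree) (hsep : f.Separable) {b : k}
    (hb : b ^ 2 = f.eval 0) (j m : ℕ) :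
    j • pointClass (Point.affine (f := f) 0 b hb) ∈ ThetaZero f m ↔
      HasFunction f hb j (j + m) ∧ ∀ n < j + m, ¬ HasFunction f hb j n := by
  rw [mem_ThetaZero_iff, nsmul_pointClass_mem_Theta_iff hf hsep]
  refine and_congr_right fun _ ↦ ⟨fun h n hn hF ↦ ?_, fun h d hd hF ↦ ?_⟩
  · have hle := hF.le hf hsep
    refine h (n - j) (by omega) ?_
    rw [nsmul_pointClass_mem_Theta_iff hf hsep, Nat.add_sub_cancel' hle]
    exact hF
  · rw [nsmul_pointClass_mem_Theta_iff hf hsep] at hF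
    exact h _ (by omega) hF

lemma exists_isMultProfile (hdeg : f.natDegree = 2 * γ + 1) (hsep : f.Separable) {b : k}
    (hb0 : b ≠ 0) (hb : b ^ 2 = f.eval 0) :
    ∃ m, IsMultProfile (pointClass (Point.affine (f := f) 0 b hb)) m := by
  classical
  have hf : Odd f.natDegree := ⟨γ, hdeg⟩
  have key : ∀ j, ∃ d, j • pointClass (Point.affine (f := f) 0 b hb) ∈ Theta f d := fun j ↦
    ⟨γ, (nsmul_pointClass_mem_Theta_iff hf hsep hb j γ).2
      (hasFunction_add_genus hdeg hsep hb0 hb j)⟩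
  exact ⟨fun j ↦ Nat.find (key j), fun j _ ↦ mem_ThetaZero_iff.2
    ⟨Nat.find_spec (key j), fun _ h ↦ Nat.find_min (key j) h⟩⟩

/-- In positive genus a function with at most a simple pole at q is constant, so it cannot vanish at
p̄ unless it is zero. -/
lemma pointClass_ne_zero (hdeg : f.natDegree = 2 * γ + 1) (hγ : 1 ≤ γ) (hsep : f.Separable)
    {b : k} (hb0 : b ≠ 0) (hb : b ^ 2 = f.eval 0) :
    pointClass (Point.affine (f := f) 0 b hb) ≠ 0 := by
  have hf : Odd f.natDegree := ⟨γ, hdeg⟩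
  intro h0
  have h1 : (1 : ℕ) • pointClass (Point.affine (f := f) 0 b hb) ∈ Theta f 0 := by
    rw [h0, Theta_zero_eq]; simp
  obtain ⟨t, ht, ht0⟩ := exists_sqrt_approx hb0 hb 1
  rw [nsmul_pointClass_mem_Theta_iff hf hsep, hasFunction_iff hdeg hsep hb0 hb ht ht0] at h1
  obtain ⟨u, v, hne, hu, hv, hd⟩ := h1
  rw [degree_lt_iff_coeff_zero] at hu hv
  obtain rfl : v = 0 := by
    ext i
    exact hv i (by omega)
  rw [zero_mul, sub_zero, X_pow_dvd_iff] at hd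
  refine hne.elim (fun h ↦ h ?_) (fun h ↦ h rfl)
  ext i
  rcases i with _ | i
  · exact hd 0 one_pos
  · exact hu _ (by omega)

lemma IsMultProfile.profileLike (hdeg : f.natDegree = 2 * γ + 1) (hγ : 1 ≤ γ)
    (hsep : f.Separable) {b : k} (hb0 : b ≠ 0) (hb : b ^ 2 = f.eval 0) {N : ℕ} (hN : 0 < N)
    (hord : addOrderOf (pointClass (Point.affine (f := f) 0 b hb)) = N) {m : ℕ → ℕ}
    (hm : IsMultProfile (pointClass (Point.affine (f := f) 0 b hb)) m) : ProfileLike γ N m := by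
  have hf : Odd f.natDegree := ⟨γ, hdeg⟩
  set x := pointClass (Point.affine (f := f) 0 b hb) with hx
  have hNx : N • x = 0 := by rw [← hord]; exact addOrderOf_nsmul_eq_zero x
  have hx1 : x ∈ Theta f 1 := pointClass_mem_Theta _
  have hmF : ∀ j, 1 ≤ j → HasFunction f hb j (j + m j) ∧
      ∀ n < j + m j, ¬ HasFunction f hb j n := fun j hj ↦
    (nsmul_mem_ThetaZero_iff hf hsep hb j (m j)).1 (hm j hj)
  have hsymm : ∀ j, 1 ≤ j → j < N → m (N - j) ≤ m j := fun j hj hjN ↦ by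
    refine hm.le_of_mem (by omega) ?_
    have : (N - j) • x = -(j • x) := by
      rw [eq_neg_iff_add_eq_zero, ← add_nsmul, Nat.sub_add_cancel hjN.le, hNx]
    rw [this]
    exact neg_mem_Theta hf hsep (hm.mem hj)
  refine ⟨?_, ?_, ?_, ?_, ?_, ?_, ?_, ?_, ?_⟩
  · refine le_antisymm (hm.le_of_mem le_rfl (by simpa using hx1)) ?_
    by_contra! h0
    have := hm.mem le_rfl
    rw [Nat.lt_one_iff.1 h0, Theta_zero_eq, one_nsmul] at this
    exact pointClass_ne_zero hdeg hγ hsep hb0 hb this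
  · exact fun j hj ↦ hm.le_of_mem hj ((nsmul_pointClass_mem_Theta_iff hf hsep hb j γ).2
      (hasFunction_add_genus hdeg hsep hb0 hb j))
  · intro j hj
    have h1 := hm (j + N) (by omega)
    rw [add_nsmul, hNx, add_zero] at h1
    exact mem_ThetaZero_unique h1 (hm j hj)
  · intro j hj hjN
    refine le_antisymm (hsymm j hj hjN) ?_
    have := hsymm (N - j) (by omega) (by omega)
    rwa [Nat.sub_sub_self hjN.le] at this
  · refine Nat.le_zero.1 (hm.le_of_mem hN ?_)
    rw [hNx, Theta_zero_eq]; rfl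
  · intro j hj
    refine hm.le_of_mem (by omega) ?_
    rw [succ_nsmul]
    exact add_mem_Theta (hm.mem hj) hx1
  · intro j hj
    refine hm.le_of_mem hj ?_
    have : j • x = (j + 1) • x + -x := by rw [succ_nsmul]; abel
    rw [this]
    exact add_mem_Theta (hm.mem (by omega)) (neg_mem_Theta hf hsep hx1)
  · rintro j a hj ⟨h1, h2, h3⟩
    have f1 := hmF j hj
    have f2 := hmF (j + 1) (by omega)
    have f3 := hmF (j + 2) (by omega)
    rw [h1] at f1
    rw [h2] at f2
    rw [h3, show j + 2 + a = j + a + 2 by omega] at f3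
    exact f2.2 (j + a + 1) (by omega) (hasFunction_of_peak hdeg hsep hb0 hb f1.1 f1.2 f3.1 f3.2)
  · rintro j a hj ha ⟨h1, h2⟩
    have f1 := hmF j hj
    have f2 := hmF (j + 1) (by omega)
    rw [h1] at f1
    rw [h2, show j + 1 + a = j + a + 1 by omega] at f2
    exact not_plateau hdeg hsep hb0 hb (by omega) f1.1 f1.2 f2.1 f2.2

/-- The least pole order at j is j + m j, so it is at most j + γ - 1 exactly when the entry is below
γ. -/
lemma IsMultProfile.hankelDet_eq_zero_iff (hdeg : f.natDegree = 2 * γ + 1)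
    (hsep : f.Separable) {b : k} (hb0 : b ≠ 0) (hb : b ^ 2 = f.eval 0) {s : PowerSeries k}
    (hs : s ^ 2 = (f : PowerSeries k)) (hsb : PowerSeries.constantCoeff s = b) {m : ℕ → ℕ}
    (hm : IsMultProfile (pointClass (Point.affine (f := f) 0 b hb)) m) {j : ℕ}
    (hj : γ + 1 ≤ j) :
    hankelDet γ (fun i ↦ PowerSeries.coeff i s) j = 0 ↔ m j < γ := by
  have hf : Odd f.natDegree := ⟨γ, hdeg⟩
  obtain ⟨h1, h2⟩ := (nsmul_mem_ThetaZero_iff hf hsep hb j (m j)).1 (hm j (by omega))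
  rw [← hasFunction_iff_hankelDet hdeg hsep hb0 hb hs hsb hj]
  constructor
  · intro h
    by_contra! hlt
    exact h2 _ (by omega) h
  · exact fun h ↦ h1.mono (by omega)

end Multiples
end OddHyperelliptic

/-! ### Comparison of a given sequence with the actual profile -/

theorem proposition4p12 {k : Type*} [Field k] [IsAlgClosed k] [CharZero k]
    (γ : ℕ) (hγ : 2 ≤ γ)
    (f : k[X]) (hdeg : f.natDegree = 2 * γ + 1) (hsep : f.Separable)
    (hf0 : f.eval 0 ≠ 0)
    (b : k) (hb : b ^ 2 = f.eval 0)
    (s : PowerSeries k) (hs : s ^ 2 = (f : PowerSeries k))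
    (hsb : PowerSeries.constantCoeff s = b)
    (N : ℕ) (hN : 0 < N)
    (hord : addOrderOf (OddHyperelliptic.pointClass
      (OddHyperelliptic.Point.affine (f := f) 0 b hb)) = N) :
    (∀ e : ℕ → ℕ, OddHyperelliptic.NecessaryConditions γ N e →
      (OddHyperelliptic.IsMultProfile
          (OddHyperelliptic.pointClass (OddHyperelliptic.Point.affine (f := f) 0 b hb)) e ↔
        ∀ j, γ + 1 ≤ j → j ≤ N / 2 →
          (OddHyperelliptic.hankelDet γ (fun i => PowerSeries.coeff i s) j = 0 ↔ e j < γ)) ∧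
      (OddHyperelliptic.IsMultProfile
          (OddHyperelliptic.pointClass (OddHyperelliptic.Point.affine (f := f) 0 b hb)) e ↔
        ∀ j, γ + 1 ≤ j → j ≤ N / 2 →
          j • OddHyperelliptic.pointClass (OddHyperelliptic.Point.affine (f := f) 0 b hb) ∈
            OddHyperelliptic.ThetaZero f (e j))) ∧
    (∀ (f' : k[X]) (b' : k) (hb' : b' ^ 2 = f'.eval 0),
      f'.natDegree = 2 * γ + 1 → f'.Separable → f'.eval 0 ≠ 0 →
      addOrderOf (OddHyperelliptic.pointClass
        (OddHyperelliptic.Point.affine (f := f') 0 b' hb')) = N →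
      ∀ e e' : ℕ → ℕ,
        OddHyperelliptic.IsMultProfile
          (OddHyperelliptic.pointClass (OddHyperelliptic.Point.affine (f := f) 0 b hb)) e →
        OddHyperelliptic.IsMultProfile
          (OddHyperelliptic.pointClass (OddHyperelliptic.Point.affine (f := f') 0 b' hb')) e' →
        (∀ j, γ + 1 ≤ j → j ≤ N / 2 → e j = e' j) →
        ∀ j, 1 ≤ j → e j = e' j) := by
  have hb0 : ∀ {f : k[X]} {b : k}, b ^ 2 = f.eval 0 → f.eval 0 ≠ 0 → b ≠ 0 := by
    rintro f b hb hf0 rfl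
    exact hf0 (by rw [← hb]; simp)
  obtain ⟨m, hm⟩ := OddHyperelliptic.exists_isMultProfile hdeg hsep (hb0 hb hf0) hb
  have hmP := hm.profileLike hdeg (by omega) hsep (hb0 hb hf0) hb hN hord
  refine ⟨fun e he ↦ ?_, ?_⟩
  · have heP := he.profileLike hN
    have hdet : ∀ j, γ + 1 ≤ j → _ := fun j hj ↦
      hm.hankelDet_eq_zero_iff hdeg hsep (hb0 hb hf0) hb hs hsb hj
    -- Both converse directions only need the places of non-maximal entries to agree with those of
    -- the true profile m.
    have hback : (∀ j, γ + 1 ≤ j → j ≤ N / 2 → (m j < γ ↔ e j < γ)) →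
        OddHyperelliptic.IsMultProfile
          (OddHyperelliptic.pointClass (OddHyperelliptic.Point.affine (f := f) 0 b hb)) e := by
      intro h j hj
      rw [← hmP.eq_of_lt_iff_of_le_half heP hN h j hj]
      exact hm j hj
    refine ⟨⟨fun h j hj _ ↦ ?_, fun h ↦ hback fun j hj hj2 ↦ ?_⟩,
      fun h j hj _ ↦ h j (by omega), fun h ↦ hback fun j hj hj2 ↦ ?_⟩
    · rw [hdet j hj, hm.ext h (by omega)]
    · rw [← hdet j hj, h j hj hj2]
    · rw [OddHyperelliptic.mem_ThetaZero_unique (hm j (by omega)) (h j hj hj2)]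
  · intro f' b' hb' hdeg' hsep' hf0' hord' e e' he he' heq
    have heP := he.profileLike hdeg (by omega) hsep (hb0 hb hf0) hb hN hord
    have heP' := he'.profileLike hdeg' (by omega) hsep' (hb0 hb' hf0') hb' hN hord'
    exact heP.eq_of_lt_iff_of_le_half heP' hN fun j hj hj2 ↦ by rw [heq j hj hj2]
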